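/- Let $\Bbbk$ be a field of characteristic $0$ and let $Q$ be a finite quiver with finite vertex set $I$ and tail and head maps $t,h:Q\to I$. Let $\bar Q$ be its double, obtained by adding an opposite arrow $a^*:h(a)\to t(a)$ for each $a\in Q$; put $(a^*)^*=a$, and let $\epsilon(a)=+1$ for $a\in Q$, $\epsilon(a)=-1$ for $a\in\bar Q\setminus Q$. Let $\Bbbk\bar Q$ be the path algebra, with vertex idempotents $e_s$ $(s\in I)$, $\sum_s e_s=1$, and $a=e_{t(a)}\,a\,e_{h(a)}$ for $a\in\bar Q$. Choose arbitrary $\gamma_a\in\Bbbk$ (possibly $0$) for $a\in Q$ and set $\gamma_{a^*}=\gamma_a$. Let $A$ be the universal localisation of $\Bbbk\bar Q$ at the elements $1+(\gamma_a-1)e_{t(a)}+aa^*$, $a\in\bar Q$; equivalently, one adjoins an inverse of $\gamma_a e_{t(a)}+aa^*$ in $e_{t(a)}Ae_{t(a)}$ for each $a\in\bar Q$. For every $s\in I$ choose a total ordering $<_s$ on $T_s=\{a\in\bar Q\mid t(a)=s\}$, and let $o_s(a,b)=+1$ if $a,b\in T_s$ and $a<_sb$, $o_s(a,b)=-1$ if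 $a,b\in T_s$ and $b<_sa$, and $o_s(a,b)=0$ otherwise. Let $B=\sum_s\Bbbk e_s\subset A$. A ($B$-linear) double bracket on $A$ is a $\Bbbk$-bilinear map $\{\!\!\{-,-\}\!\!\}:A\times A\to A\otimes A$ that vanishes when one argument is in $B$ and satisfies $\{\!\!\{a,b\}\!\!\}=-\{\!\!\{b,a\}\!\!\}^\circ$ (where $(x\otimes y)^\circ=y\otimes x$) and $\{\!\!\{a,bc\}\!\!\}=\{\!\!\{a,b\}\!\!\}c+b\{\!\!\{a,c\}\!\!\}$, where $b(x\otimes y)c=bx\otimes yc$. With $\{\!\!\{b,c\}\!\!\}=\{\!\!\{b,c\}\!\!\}'\otimes\{\!\!\{b,c\}\!\!\}''$ (Sweedler's notation) and $\tau(a_1\otimes a_2\otimes a_3)=a_3\otimes a_1\otimes a_2$, its triple bracket is $$\{\!\!\{a,b,c\}\!\!\}=\{\!\!\{a,\{\!\!\{b,c\}\!\!\}'\}\!\!\}\otimes\{\!\!\{b,c\}\!\!\}''+\tau\big(\{\!\!\{b,\{\!\!\{c,a\}\!\!\}'\}\!\!\}\otimes\{\!\!\{c,a\}\!\!\}''\big)+\tau^2\big(\{\!\!\{c,\{\!\!\{a,b\}\!\!\}'\}\!\!\}\otimes\{\!\!\{a,b\}\!\!\}''\big).$$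 The double bracket is called quasi-Poisson if for all $a,b,c\in A$ $$\begin{aligned}\{\!\!\{a,b,c\}\!\!\}=\tfrac14\sum_{s\in I}\big(&ce_sa\otimes e_sb\otimes e_s-ce_sa\otimes e_s\otimes be_s-ce_s\otimes ae_sb\otimes e_s+ce_s\otimes ae_s\otimes be_s\\&-e_sa\otimes e_sb\otimes e_sc+e_sa\otimes e_s\otimes be_sc+e_s\otimes ae_sb\otimes e_sc-e_s\otimes ae_s\otimes be_sc\big).\end{aligned}$$ **Theorem.** There is a unique double bracket on $A$ such that $$\{\!\!\{a,a\}\!\!\}=\tfrac12\,o_{t(a)}(a,a^*)\,\big(a^2\otimes e_{t(a)}-e_{h(a)}\otimes a^2\big)\qquad(a\in\bar Q),$$ $$\{\!\!\{a,a^*\}\!\!\}=\gamma_a\,e_{h(a)}\otimes e_{t(a)}+\tfrac12\,a^*a\otimes e_{t(a)}+\tfrac12\,e_{h(a)}\otimes aa^*+\tfrac12\,o_{t(a)}(a,a^*)\,(a^*\otimes a-a\otimes a^*)\qquad(a\in Q),$$ and, for $b,c\in\bar Q$ with $c\neq b,b^*$, $$\{\!\!\{b,c\}\!\!\}=-\tfrac12\,o_{t(b)}(b,c)\,b\otimes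 c-\tfrac12\,o_{h(b)}(b^*,c^*)\,c\otimes b+\tfrac12\,o_{t(b)}(b,c^*)\,cb\otimes e_{t(b)}+\tfrac12\,o_{h(b)}(b^*,c)\,e_{h(b)}\otimes bc .$$ This double bracket is quasi-Poisson. Furthermore, $A$ is quasi-Hamiltonian with multiplicative moment map $$\Phi=\sum_{s\in I}\Phi_s,\qquad \Phi_s=\prod_{a\in T_s}^{\longrightarrow}(\gamma_ae_s+aa^*)^{\epsilon(a)}\in e_sAe_s,$$ where the product and the inverses are taken in $e_sAe_s$ (so $\Phi_s=e_s$ if $T_s=\emptyset$) and the factors are written from left to right in increasing order for $<_s$; that is, $\Phi$ is invertible in $A$ and, for all $s\in I$ and $a\in A$, $$\{\!\!\{\Phi_s,a\}\!\!\}=\tfrac12\big(ae_s\otimes\Phi_s-e_s\otimes\Phi_sa+a\Phi_s\otimes e_s-\Phi_s\otimes e_sa\big).$$ -/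

import Mathlib

open scoped TensorProduct

noncomputable section

/-! ### Double brackets and quasi-Hamiltonian algebras -/

namespace DoubleBracket

variable (k : Type*) [Field k] {A : Type*} [Ring A] [Algebra k A]

/-- Left part of the outer bimodule structure: `b · (x ⊗ y) = (b x) ⊗ y`. -/
def outerLeft (b : A) : A ⊗[k] A →ₗ[k] A ⊗[k] A :=
  LinearMap.rTensor A (LinearMap.mulLeft k b)

/-- Right part of the outer bimodule structure: `(x ⊗ y) · c = x ⊗ (y c)`. -/
def outerRight (c : A) : A ⊗[k] A →ₗ[k] A ⊗[k] A :=
  LinearMap.lTensor A (LinearMap.mulRight k c)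

/-- A `k`-bilinear map `D : A × A → A ⊗ A` is a `B`-linear double bracket, where `B` is the span of
the family `e`: cyclic antisymmetry, the right derivation rule `{a, bc} = {a, b} c + b {a, c}` for
the outer bimodule structure, and vanishing as soon as one argument lies in `B`. -/
structure IsDoubleBracket {I : Type*} (e : I → A) (D : A →ₗ[k] A →ₗ[k] A ⊗[k] A) : Prop where
  antisymm : ∀ a b : A, D a b = -(TensorProduct.comm k A A (D b a))
  deriv : ∀ a b c : A, D a (b * c) = outerRight k c (D a b) + outerLeft k b (D a c)
  base_left : ∀ b ∈ Submodule.span k (Set.range e), ∀ a : A, D b a = 0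
  base_right : ∀ b ∈ Submodule.span k (Set.range e), ∀ a : A, D a b = 0

/-- The cyclic permutation `a₁ ⊗ a₂ ⊗ a₃ ↦ a₃ ⊗ a₁ ⊗ a₂`. -/
def cyc : A ⊗[k] A ⊗[k] A →ₗ[k] A ⊗[k] A ⊗[k] A :=
  (TensorProduct.assoc k A A A).symm.toLinearMap ∘ₗ
    (TensorProduct.comm k (A ⊗[k] A) A).toLinearMap

variable {k}

/-- `x ⊗ y ↦ {a, x} ⊗ y`. -/
def extend (D : A →ₗ[k] A →ₗ[k] A ⊗[k] A) (a : A) : A ⊗[k] A →ₗ[k] A ⊗[k] A ⊗[k] A :=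
  LinearMap.rTensor A (D a)

/-- The triple bracket associated with `D`:
`{a,{b,c}'} ⊗ {b,c}'' + τ ({b,{c,a}'} ⊗ {c,a}'') + τ² ({c,{a,b}'} ⊗ {a,b}'')`. -/
def triple (D : A →ₗ[k] A →ₗ[k] A ⊗[k] A) (a b c : A) : A ⊗[k] A ⊗[k] A :=
  extend D a (D b c) + cyc k (extend D b (D c a)) + cyc k (cyc k (extend D c (D a b)))

variable (k)

/-- `(A, D)` is a double quasi-Poisson algebra over `B = ⊕ₛ k eₛ`. -/
structure IsDoubleQuasiPoisson {I : Type*} [Fintype I] (e : I → A)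
    (D : A →ₗ[k] A →ₗ[k] A ⊗[k] A) : Prop where
  idempotents : CompleteOrthogonalIdempotents e
  isDoubleBracket : IsDoubleBracket k e D
  quasiPoisson : ∀ a b c : A, triple D a b c = (1 / 4 : k) • ∑ s : I,
    ((c * e s * a) ⊗ₜ[k] (e s * b) ⊗ₜ[k] e s
      - (c * e s * a) ⊗ₜ[k] e s ⊗ₜ[k] (b * e s)
      - (c * e s) ⊗ₜ[k] (a * e s * b) ⊗ₜ[k] e s
      + (c * e s) ⊗ₜ[k] (a * e s) ⊗ₜ[k] (b * e s)
      - (e s * a) ⊗ₜ[k] (e s * b) ⊗ₜ[k] (e s * c)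
      + (e s * a) ⊗ₜ[k] e s ⊗ₜ[k] (b * e s * c)
      + e s ⊗ₜ[k] (a * e s * b) ⊗ₜ[k] (e s * c)
      - e s ⊗ₜ[k] (a * e s) ⊗ₜ[k] (b * e s * c))

/-- The family `Φₛ ∈ eₛ A eₛ` is such that `Φ = ∑ₛ Φₛ` is a multiplicative moment map. -/
structure IsMomentMap {I : Type*} [Fintype I] (e : I → A)
    (D : A →ₗ[k] A →ₗ[k] A ⊗[k] A) (Φ : I → A) : Prop where
  corner : ∀ s : I, e s * Φ s * e s = Φ s
  invertible : IsUnit (∑ s : I, Φ s)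
  moment : ∀ (s : I) (a : A), D (Φ s) a = (1 / 2 : k) •
    ((a * e s) ⊗ₜ[k] Φ s - e s ⊗ₜ[k] (Φ s * a) + (a * Φ s) ⊗ₜ[k] e s - Φ s ⊗ₜ[k] (e s * a))

end DoubleBracket

/-! ### Universal localisation -/

section UniversalLocalisation

variable (k : Type*) [Field k] {R : Type*} [Ring R] [Algebra k R] (S : Set R)

/-- Relations presenting the `k`-algebra obtained from `R` by adjoining inverses of the elements
of `S`: the first three say that `r ↦ ι (inl r)` is a homomorphism of `k`-algebras, the last two
that `ι (inr s)` is a two-sided inverse of `s ∈ S`. -/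
inductive UnivLocRel : FreeAlgebra k (R ⊕ S) → FreeAlgebra k (R ⊕ S) → Prop
  | add (r r' : R) : UnivLocRel (FreeAlgebra.ι k (Sum.inl (r + r')))
      (FreeAlgebra.ι k (Sum.inl r) + FreeAlgebra.ι k (Sum.inl r'))
  | mul (r r' : R) : UnivLocRel (FreeAlgebra.ι k (Sum.inl (r * r')))
      (FreeAlgebra.ι k (Sum.inl r) * FreeAlgebra.ι k (Sum.inl r'))
  | scalar (c : k) : UnivLocRel (FreeAlgebra.ι k (Sum.inl (algebraMap k R c)))
      (algebraMap k (FreeAlgebra k (R ⊕ S)) c)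
  | mul_inv (s : S) : UnivLocRel
      (FreeAlgebra.ι k (Sum.inl (s : R)) * FreeAlgebra.ι k (Sum.inr s)) 1
  | inv_mul (s : S) : UnivLocRel
      (FreeAlgebra.ι k (Sum.inr s) * FreeAlgebra.ι k (Sum.inl (s : R))) 1

/-- The universal localisation `R_S`. -/
def UnivLoc : Type _ := RingQuot (UnivLocRel k S)

namespace UnivLoc

instance : Ring (UnivLoc k S) := inferInstanceAs (Ring (RingQuot (UnivLocRel k S)))

instance : Algebra k (UnivLoc k S) := inferInstanceAs (Algebra k (RingQuot (UnivLocRel k S)))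

/-- The presentation map from the free algebra. -/
def mk : FreeAlgebra k (R ⊕ S) →ₐ[k] UnivLoc k S := RingQuot.mkAlgHom k (UnivLocRel k S)

theorem mk_rel {x y : FreeAlgebra k (R ⊕ S)} (h : UnivLocRel k S x y) : mk k S x = mk k S y :=
  RingQuot.mkAlgHom_rel k h

/-- The canonical homomorphism `R → R_S`. -/
def of : R →ₐ[k] UnivLoc k S where
  toFun r := mk k S (FreeAlgebra.ι k (Sum.inl r))
  map_one' := by
    have h := mk_rel k S (UnivLocRel.scalar (S := S) (1 : k))
    simpa using h
  map_mul' r r' := by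
    have h := mk_rel k S (UnivLocRel.mul r r')
    simpa using h
  map_zero' := by
    have h := mk_rel k S (UnivLocRel.scalar (S := S) (0 : k))
    simpa using h
  map_add' r r' := by
    have h := mk_rel k S (UnivLocRel.add r r')
    simpa using h
  commutes' c := by
    have h := mk_rel k S (UnivLocRel.scalar (S := S) c)
    simpa using h

/-- The adjoined inverse of `s ∈ S`. -/
def inv (s : S) : UnivLoc k S := mk k S (FreeAlgebra.ι k (Sum.inr s))

theorem of_mul_inv (s : S) : of k S (s : R) * inv k S s = 1 := by
  have h := mk_rel k S (UnivLocRel.mul_inv s)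
  rw [map_mul, map_one] at h
  exact h

theorem inv_mul_of (s : S) : inv k S s * of k S (s : R) = 1 := by
  have h := mk_rel k S (UnivLocRel.inv_mul s)
  rw [map_mul, map_one] at h
  exact h

end UnivLoc

end UniversalLocalisation

/-! ### Quivers, doubles and path algebras -/

/-- A quiver with vertex set `I` and arrow set `Q`, given by its tail and head functions. -/
structure ArrowQuiver (I Q : Type*) where
  tail : Q → I
  head : Q → I

namespace ArrowQuiver

variable {I Q : Type*}

/-- The double quiver: `inl a` is the arrow `a ∈ Q` and `inr a` its opposite `a* : h(a) → t(a)`. -/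
def double (G : ArrowQuiver I Q) : ArrowQuiver I (Q ⊕ Q) where
  tail := Sum.elim G.tail G.head
  head := Sum.elim G.head G.tail

/-- The involution `a ↦ a*` on the arrows of the double. -/
def star (a : Q ⊕ Q) : Q ⊕ Q := Sum.swap a

/-- The set `T_s` of arrows with tail `s`. -/
abbrev ArrowsFrom (G : ArrowQuiver I Q) (s : I) : Type _ := {a : Q // G.tail a = s}

open Classical in
/-- The ordering function `o_s(a, b)` of total orderings of the sets `T_s`: it is `1` if `a < b`
in `T_s`, `-1` if `b < a` in `T_s`, and `0` if `a = b` or if `a ∉ T_s` or `b ∉ T_s`. -/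
def orderSign (G : ArrowQuiver I Q) (ord : ∀ s, LinearOrder (G.ArrowsFrom s)) (s : I) (a b : Q) :
    ℤ :=
  if h : G.tail a = s ∧ G.tail b = s then
    if (ord s).lt ⟨a, h.1⟩ ⟨b, h.2⟩ then 1
    else if (ord s).lt ⟨b, h.2⟩ ⟨a, h.1⟩ then -1
    else 0
  else 0

section PathAlgebra

variable (k : Type*) [Field k] [Fintype I] (G : ArrowQuiver I Q)

/-- The relations of the path algebra; paths are read from left to right, that is
`a = e_{t(a)} a e_{h(a)}`, and `inl s` is the symbol of the idempotent `e_s`. -/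
inductive PathRel : FreeAlgebra k (I ⊕ Q) → FreeAlgebra k (I ⊕ Q) → Prop
  | idem (s : I) : PathRel
      (FreeAlgebra.ι k (Sum.inl s) * FreeAlgebra.ι k (Sum.inl s)) (FreeAlgebra.ι k (Sum.inl s))
  | orth (s t : I) (h : s ≠ t) : PathRel
      (FreeAlgebra.ι k (Sum.inl s) * FreeAlgebra.ι k (Sum.inl t)) 0
  | complete : PathRel (∑ s : I, FreeAlgebra.ι k (Sum.inl s)) 1
  | arrow (a : Q) : PathRel (FreeAlgebra.ι k (Sum.inr a))
      (FreeAlgebra.ι k (Sum.inl (G.tail a)) * FreeAlgebra.ι k (Sum.inr a)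
        * FreeAlgebra.ι k (Sum.inl (G.head a)))

/-- The path algebra `kQ`. -/
def PathAlgebra : Type _ := RingQuot (PathRel k G)

namespace PathAlgebra

instance : Ring (PathAlgebra k G) := inferInstanceAs (Ring (RingQuot (PathRel k G)))

instance : Algebra k (PathAlgebra k G) := inferInstanceAs (Algebra k (RingQuot (PathRel k G)))

/-- The presentation map from the free algebra. -/
def mk : FreeAlgebra k (I ⊕ Q) →ₐ[k] PathAlgebra k G := RingQuot.mkAlgHom k (PathRel k G)

/-- The idempotent `e_s`. -/
def vertex (s : I) : PathAlgebra k G := mk k G (FreeAlgebra.ι k (Sum.inl s))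

/-- The arrow `a` as an element of the path algebra. -/
def arrow (a : Q) : PathAlgebra k G := mk k G (FreeAlgebra.ι k (Sum.inr a))

theorem mk_rel {x y : FreeAlgebra k (I ⊕ Q)} (h : PathRel k G x y) : mk k G x = mk k G y :=
  RingQuot.mkAlgHom_rel k h

theorem vertex_orth {s t : I} (h : s ≠ t) : vertex k G s * vertex k G t = 0 := by
  simpa [vertex] using mk_rel k G (PathRel.orth (G := G) s t h)

theorem vertex_complete : ∑ s : I, vertex k G s = 1 := by
  simpa [vertex] using mk_rel k G (PathRel.complete (G := G))

theorem vertex_idem (s : I) : vertex k G s * vertex k G s = vertex k G s := by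
  simpa [vertex] using mk_rel k G (PathRel.idem (G := G) s)

theorem arrow_eq (a : Q) :
    arrow k G a = vertex k G (G.tail a) * arrow k G a * vertex k G (G.head a) := by
  simpa [vertex, arrow] using mk_rel k G (PathRel.arrow (G := G) a)

theorem vertex_mul_arrow (a : Q) : vertex k G (G.tail a) * arrow k G a = arrow k G a := by
  rw [arrow_eq k G a]
  simp only [← mul_assoc, vertex_idem]

theorem arrow_mul_vertex (a : Q) : arrow k G a * vertex k G (G.head a) = arrow k G a := by
  rw [arrow_eq k G a]
  simp only [mul_assoc, vertex_idem]

end PathAlgebra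

end PathAlgebra

section Localised

variable {k : Type*} [Field k] [Fintype I] (G : ArrowQuiver I Q) (γ : Q → k)

/-- The extension of `γ` to the arrows of the double, `γ_{a*} = γ_a`. -/
def gammaBar (a : Q ⊕ Q) : k := Sum.elim γ γ a

/-- The element `1 + (γ_a - 1) e_{t(a)} + a a*` of the path algebra of the double. -/
def locElt (a : Q ⊕ Q) : PathAlgebra k G.double :=
  1 + (gammaBar γ a - 1) • PathAlgebra.vertex k G.double (G.double.tail a)
    + PathAlgebra.arrow k G.double a * PathAlgebra.arrow k G.double (star a)

/-- The algebra `A`: the universal localisation of the path algebra of the double at the elements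
`1 + (γ_a - 1) e_{t(a)} + a a*`, where `a` runs over all arrows of the double. -/
abbrev LocAlgebra : Type _ := UnivLoc k (Set.range (locElt G γ))

/-- The idempotent `e_s` in `A`. -/
def e (s : I) : LocAlgebra G γ := UnivLoc.of k _ (PathAlgebra.vertex k G.double s)

/-- The arrow `a` of the double in `A`. -/
def arr (a : Q ⊕ Q) : LocAlgebra G γ := UnivLoc.of k _ (PathAlgebra.arrow k G.double a)

/-- The element `γ_a e_{t(a)} + a a*` of `e_{t(a)} A e_{t(a)}`. -/
def localElt (a : Q ⊕ Q) : LocAlgebra G γ :=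
  gammaBar γ a • e G γ (G.double.tail a) + arr G γ a * arr G γ (star a)

/-- The inverse of `γ_a e_{t(a)} + a a*` in `e_{t(a)} A e_{t(a)}`: the corner of the inverse of
`1 + (γ_a - 1) e_{t(a)} + a a*`. -/
def localInv (a : Q ⊕ Q) : LocAlgebra G γ :=
  e G γ (G.double.tail a) * UnivLoc.inv k (Set.range (locElt G γ)) ⟨locElt G γ a, a, rfl⟩ * e G γ (G.double.tail a)

theorem e_idem (s : I) : e G γ s * e G γ s = e G γ s := by
  rw [e, ← map_mul, PathAlgebra.vertex_idem]

theorem e_completeOrthogonalIdempotents : CompleteOrthogonalIdempotents (e G γ) where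
  idem s := e_idem G γ s
  ortho := fun s t h => by
    change e G γ s * e G γ t = 0
    rw [e, e, ← map_mul, PathAlgebra.vertex_orth k G.double h, map_zero]
  complete := by
    simp only [e, ← map_sum, PathAlgebra.vertex_complete, map_one]

theorem e_mul_arr (a : Q ⊕ Q) : e G γ (G.double.tail a) * arr G γ a = arr G γ a := by
  rw [e, arr, ← map_mul, PathAlgebra.vertex_mul_arrow]

theorem arr_mul_e (a : Q ⊕ Q) : arr G γ (star a) * e G γ (G.double.tail a) = arr G γ (star a) := by
  have h : G.double.head (star a) = G.double.tail a := by cases a <;> rfl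
  rw [e, arr, ← map_mul, ← h, PathAlgebra.arrow_mul_vertex]

theorem of_locElt (a : Q ⊕ Q) : UnivLoc.of k (Set.range (locElt G γ)) (locElt G γ a) =
    1 + (gammaBar γ a - 1) • e G γ (G.double.tail a) + arr G γ a * arr G γ (star a) := by
  simp only [e, arr, ← map_mul, ← map_smul]
  rw [← map_one (UnivLoc.of k (Set.range (locElt G γ))), ← map_add, ← map_add]
  rfl

theorem e_mul_of_locElt (a : Q ⊕ Q) : e G γ (G.double.tail a) *
    UnivLoc.of k (Set.range (locElt G γ)) (locElt G γ a) = localElt G γ a := by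
  rw [of_locElt, localElt, mul_add, mul_add, mul_smul_comm, e_idem, ← mul_assoc, e_mul_arr, mul_one,
    sub_smul, one_smul, add_sub_cancel]

theorem of_locElt_mul_e (a : Q ⊕ Q) : UnivLoc.of k (Set.range (locElt G γ)) (locElt G γ a) *
    e G γ (G.double.tail a) = localElt G γ a := by
  rw [of_locElt, localElt, add_mul, add_mul, smul_mul_assoc, e_idem, mul_assoc, arr_mul_e, one_mul,
    sub_smul, one_smul, add_sub_cancel]

theorem localElt_mul_localInv (a : Q ⊕ Q) :
    localElt G γ a * localInv G γ a = e G γ (G.double.tail a) := by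
  have h₁ := UnivLoc.of_mul_inv k (Set.range (locElt G γ)) ⟨locElt G γ a, a, rfl⟩
  calc _ = (localElt G γ a * e G γ (G.double.tail a)) *
          UnivLoc.inv k (Set.range (locElt G γ)) ⟨locElt G γ a, a, rfl⟩ *
          e G γ (G.double.tail a) := by simp only [localInv, mul_assoc]
    _ = e G γ (G.double.tail a) := by
      rw [← of_locElt_mul_e, mul_assoc _ (e G γ _) (e G γ _), e_idem, of_locElt_mul_e,
        ← e_mul_of_locElt, mul_assoc (e G γ _), h₁, mul_one, e_idem]

theorem localInv_mul_localElt (a : Q ⊕ Q) :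
    localInv G γ a * localElt G γ a = e G γ (G.double.tail a) := by
  have h₁ := UnivLoc.inv_mul_of k (Set.range (locElt G γ)) ⟨locElt G γ a, a, rfl⟩
  calc _ = e G γ (G.double.tail a) *
          (UnivLoc.inv k (Set.range (locElt G γ)) ⟨locElt G γ a, a, rfl⟩ *
          (e G γ (G.double.tail a) * localElt G γ a)) := by simp only [localInv, mul_assoc]
    _ = e G γ (G.double.tail a) := by
      rw [← e_mul_of_locElt, ← mul_assoc (e G γ _) (e G γ _), e_idem, e_mul_of_locElt,
        ← of_locElt_mul_e, ← mul_assoc (UnivLoc.inv k _ _), h₁, one_mul, e_idem]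

/-- The factor `(γ_a e_{t(a)} + a a*)^{ε(a)}`, where `ε = 1` on `Q` and `ε = -1` on the opposite
arrows. -/
def momentFactor : Q ⊕ Q → LocAlgebra G γ
  | Sum.inl a => localElt G γ (Sum.inl a)
  | Sum.inr a => localInv G γ (Sum.inr a)

/-- `Φ_s`: the product of the factors `(γ_a e_s + a a*)^{ε(a)}` over `a ∈ T_s`, in increasing order;
the product is taken in `e_s A e_s`, so that it is `e_s` if `T_s` is empty. -/
def momentComponent [Fintype Q] [DecidableEq I] (ord : ∀ s, LinearOrder (G.double.ArrowsFrom s))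
    (s : I) : LocAlgebra G γ :=
  letI := ord s
  e G γ s * (((Finset.univ : Finset (G.double.ArrowsFrom s)).sort (· ≤ ·)).map
    fun a => momentFactor G γ (a : Q ⊕ Q)).prod

/-- The prescribed values on the arrows of the double:
`{a, a} = ½ o(a, a*) (a² ⊗ e_{t(a)} - e_{h(a)} ⊗ a²)` for all `a`,
`{a, a*} = γ_a e_{h(a)} ⊗ e_{t(a)} + ½ a*a ⊗ e_{t(a)} + ½ e_{h(a)} ⊗ aa*
  + ½ o(a, a*) (a* ⊗ a - a ⊗ a*)` for `a ∈ Q`, and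
`{b, c} = -½ o(b, c) b ⊗ c - ½ o(b*, c*) c ⊗ b + ½ o(b, c*) cb ⊗ e_{t(b)}
  + ½ o(b*, c) e_{h(b)} ⊗ bc` for `c ≠ b, b*`. -/
structure HasQuiverValues (ord : ∀ s, LinearOrder (G.double.ArrowsFrom s))
    (D : LocAlgebra G γ →ₗ[k] LocAlgebra G γ →ₗ[k] LocAlgebra G γ ⊗[k] LocAlgebra G γ) : Prop where
  self : ∀ a : Q ⊕ Q, D (arr G γ a) (arr G γ a) =
    ((1 / 2 : k) * (G.double.orderSign ord (G.double.tail a) a (star a) : k)) •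
      ((arr G γ a * arr G γ a) ⊗ₜ[k] e G γ (G.double.tail a)
        - e G γ (G.double.head a) ⊗ₜ[k] (arr G γ a * arr G γ a))
  opposite : ∀ a₀ : Q, let a : Q ⊕ Q := Sum.inl a₀
    D (arr G γ a) (arr G γ (star a)) =
      gammaBar γ a • (e G γ (G.double.head a) ⊗ₜ[k] e G γ (G.double.tail a))
      + (1 / 2 : k) • ((arr G γ (star a) * arr G γ a) ⊗ₜ[k] e G γ (G.double.tail a))
      + (1 / 2 : k) • (e G γ (G.double.head a) ⊗ₜ[k] (arr G γ a * arr G γ (star a)))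
      + ((1 / 2 : k) * (G.double.orderSign ord (G.double.tail a) a (star a) : k)) •
        (arr G γ (star a) ⊗ₜ[k] arr G γ a - arr G γ a ⊗ₜ[k] arr G γ (star a))
  distinct : ∀ b c : Q ⊕ Q, c ≠ b → c ≠ star b → D (arr G γ b) (arr G γ c) =
    -(((1 / 2 : k) * (G.double.orderSign ord (G.double.tail b) b c : k)) •
        (arr G γ b ⊗ₜ[k] arr G γ c))
    - ((1 / 2 : k) * (G.double.orderSign ord (G.double.head b) (star b) (star c) : k)) •
        (arr G γ c ⊗ₜ[k] arr G γ b)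
    + ((1 / 2 : k) * (G.double.orderSign ord (G.double.tail b) b (star c) : k)) •
        ((arr G γ c * arr G γ b) ⊗ₜ[k] e G γ (G.double.tail b))
    + ((1 / 2 : k) * (G.double.orderSign ord (G.double.head b) (star b) c : k)) •
        (e G γ (G.double.head b) ⊗ₜ[k] (arr G γ b * arr G γ c))

end Localised

end ArrowQuiver
end

/-! A double bracket is a derivation in each argument: for the outer bimodule structure of `A ⊗ A`
in the second, and, by antisymmetry, for the inner one in the first. A derivation of the localised
algebra `A` into a bimodule `M` is an algebra map into the square-zero extension of `A` by `M`
lifting the identity. An element of that extension is a unit as soon as its image in `A` is, so such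
a derivation is determined by its values on arrows, and these may be prescribed freely in the
appropriate corners. Applying this once in each argument gives existence and uniqueness
(`exists_derivation`, `derivation_eq_zero`, `exists_doubleBracket`). The same principle reduces the
quasi-Poisson identity and the moment map identity to arrows, since all sides are derivations
(`triple_mul_right`, `quasiTerm_mul_right`).

On arrows all prescribed values follow one formula, `fusionValue` plus a correction `pairValue`
present only for opposite arrows. The correction is the bracket of a quiver whose arrow ends are all
separated; the first part comes from gluing the ends in order at the vertices. The triple bracket of
three arrows splits accordingly. Products of two fusion parts give cyclic sums of products of
ordering signs (`fusionTriple_cyclic_sum`), mixed products cancel (`mixedTriple_sum`), and products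
of two corrections give the terms where three ends are identical (`pairTriple_cyclic_sum`). For
three elements of a totally ordered set, not all equal, the cyclic sum `o(x,y)o(y,z) + o(y,z)o(z,x)
+ o(z,x)o(x,y)` is `-1` (`endSign_cyclic`). The first and third contributions therefore add up to a
quarter of the sum over all triples of ends at a common vertex, which is the quasi-Poisson right
hand side.

For the moment map, the two inner ends in a factor `γ_x e + x x*` cancel in a bracket with an arrow
`c`, so only the position of `x` relative to the two ends of `c` matters. Inverting a factor
reverses the correction but not the fusion part, whence the exponents `ε`. The Leibniz rule for the
ordered product then telescopes, the sign changing exactly at the factor of the end of `c`; the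
result does not depend on where that factor stands. -/

open scoped TensorProduct

noncomputable section

namespace DoubleBracket

/-! ### The outer and inner bimodule structures on `A ⊗ A`, and the outer one on `A ⊗ A ⊗ A`. -/

section Bimodules

variable (k : Type*) [Field k] {A : Type*} [Ring A] [Algebra k A]

/-- Left part of the inner bimodule structure: `b * (x ⊗ y) = x ⊗ (b y)`. -/
def innerLeft (b : A) : A ⊗[k] A →ₗ[k] A ⊗[k] A :=
  LinearMap.lTensor A (LinearMap.mulLeft k b)

/-- Right part of the inner bimodule structure: `(x ⊗ y) * c = (x c) ⊗ y`. -/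
def innerRight (c : A) : A ⊗[k] A →ₗ[k] A ⊗[k] A :=
  LinearMap.rTensor A (LinearMap.mulRight k c)

@[simp] theorem outerLeft_tmul (b x y : A) : outerLeft k b (x ⊗ₜ y) = (b * x) ⊗ₜ y := rfl
@[simp] theorem outerRight_tmul (b x y : A) : outerRight k b (x ⊗ₜ y) = x ⊗ₜ (y * b) := rfl
@[simp] theorem innerLeft_tmul (b x y : A) : innerLeft k b (x ⊗ₜ y) = x ⊗ₜ (b * y) := rfl
@[simp] theorem innerRight_tmul (b x y : A) : innerRight k b (x ⊗ₜ y) = (x * b) ⊗ₜ y := rfl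

/-- The outer left action as a homomorphism. -/
def outerLeftHom : A →ₐ[k] Module.End k (A ⊗[k] A) :=
  AlgHom.ofLinearMap (LinearMap.rTensorHom A ∘ₗ LinearMap.mul k A)
    (by ext; simp) (fun x y => by ext; simp [mul_assoc])

/-- The outer right action as a homomorphism. -/
def outerRightHom : Aᵐᵒᵖ →ₐ[k] Module.End k (A ⊗[k] A) :=
  AlgHom.ofLinearMap (LinearMap.lTensorHom A ∘ₗ (LinearMap.mul k A).flip ∘ₗ
      (MulOpposite.opLinearEquiv k).symm.toLinearMap)
    (by ext; simp) (fun x y => by ext; simp [mul_assoc])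

theorem outerLeft_outerRight (a b : A) (w : A ⊗[k] A) :
    outerLeft k a (outerRight k b w) = outerRight k b (outerLeft k a w) := by
  induction w <;> simp_all

theorem outerLeft_innerLeft (a b : A) (w : A ⊗[k] A) :
    outerLeft k a (innerLeft k b w) = innerLeft k b (outerLeft k a w) := by
  induction w <;> simp_all

theorem outerLeft_innerRight (a b : A) (w : A ⊗[k] A) :
    outerLeft k a (innerRight k b w) = innerRight k b (outerLeft k a w) := by
  induction w <;> simp_all [mul_assoc]

theorem outerRight_innerLeft (a b : A) (w : A ⊗[k] A) :
    outerRight k a (innerLeft k b w) = innerLeft k b (outerRight k a w) := by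
  induction w <;> simp_all [mul_assoc]

theorem outerRight_innerRight (a b : A) (w : A ⊗[k] A) :
    outerRight k a (innerRight k b w) = innerRight k b (outerRight k a w) := by
  induction w <;> simp_all

theorem innerLeft_innerRight (a b : A) (w : A ⊗[k] A) :
    innerLeft k a (innerRight k b w) = innerRight k b (innerLeft k a w) := by
  induction w <;> simp_all

theorem innerLeft_one (w : A ⊗[k] A) : innerLeft k 1 w = w := by
  induction w <;> simp_all

theorem innerRight_one (w : A ⊗[k] A) : innerRight k 1 w = w := by
  induction w <;> simp_all

theorem innerLeft_mul (a b : A) (w : A ⊗[k] A) :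
    innerLeft k (a * b) w = innerLeft k a (innerLeft k b w) := by
  induction w <;> simp_all [mul_assoc]

theorem innerRight_mul (a b : A) (w : A ⊗[k] A) :
    innerRight k (a * b) w = innerRight k b (innerRight k a w) := by
  induction w <;> simp_all [mul_assoc]

theorem comm_outerLeft (a : A) (w : A ⊗[k] A) :
    TensorProduct.comm k A A (outerLeft k a w) = innerLeft k a (TensorProduct.comm k A A w) := by
  induction w <;> simp_all

theorem comm_outerRight (a : A) (w : A ⊗[k] A) :
    TensorProduct.comm k A A (outerRight k a w) = innerRight k a (TensorProduct.comm k A A w) := by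
  induction w <;> simp_all

theorem comm_innerLeft (a : A) (w : A ⊗[k] A) :
    TensorProduct.comm k A A (innerLeft k a w) = outerLeft k a (TensorProduct.comm k A A w) := by
  induction w <;> simp_all

theorem comm_innerRight (a : A) (w : A ⊗[k] A) :
    TensorProduct.comm k A A (innerRight k a w) = outerRight k a (TensorProduct.comm k A A w) := by
  induction w <;> simp_all

/-- Postcomposition with the inner left action. -/
def innerLeftHom : A →ₐ[k] Module.End k (A →ₗ[k] A ⊗[k] A) :=
  AlgHom.ofLinearMap (LinearMap.llcomp k A (A ⊗[k] A) (A ⊗[k] A) ∘ₗ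
      LinearMap.lTensorHom A ∘ₗ LinearMap.mul k A)
    (by ext f z; exact innerLeft_one k (f z)) (fun x y => by
      ext f z
      change LinearMap.lTensor A (LinearMap.mulLeft k (x * y)) (f z) =
        LinearMap.lTensor A (LinearMap.mulLeft k x) (LinearMap.lTensor A (LinearMap.mulLeft k y) (f z))
      exact innerLeft_mul k x y (f z))

/-- Postcomposition with the inner right action. -/
def innerRightHom : Aᵐᵒᵖ →ₐ[k] Module.End k (A →ₗ[k] A ⊗[k] A) :=
  AlgHom.ofLinearMap (LinearMap.llcomp k A (A ⊗[k] A) (A ⊗[k] A) ∘ₗ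
      LinearMap.rTensorHom A ∘ₗ (LinearMap.mul k A).flip ∘ₗ
      (MulOpposite.opLinearEquiv k).symm.toLinearMap)
    (by ext f z; exact innerRight_one k (f z)) (fun x y => by
      ext f z
      exact innerRight_mul k y.unop x.unop (f z))

/-- Left multiplication on the first factor of `A ⊗ A ⊗ A`. -/
def outerLeft₃ (b : A) : A ⊗[k] A ⊗[k] A →ₗ[k] A ⊗[k] A ⊗[k] A :=
  LinearMap.rTensor A (outerLeft k b)

/-- Right multiplication on the last factor of `A ⊗ A ⊗ A`. -/
def outerRight₃ (b : A) : A ⊗[k] A ⊗[k] A →ₗ[k] A ⊗[k] A ⊗[k] A :=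
  LinearMap.lTensor (A ⊗[k] A) (LinearMap.mulRight k b)

@[simp] theorem outerLeft₃_tmul (b : A) (x : A ⊗[k] A) (y : A) :
    outerLeft₃ k b (x ⊗ₜ y) = outerLeft k b x ⊗ₜ y := rfl
@[simp] theorem outerRight₃_tmul (b : A) (x : A ⊗[k] A) (y : A) :
    outerRight₃ k b (x ⊗ₜ y) = x ⊗ₜ (y * b) := rfl
@[simp] theorem cyc_tmul (x y z : A) : cyc k (x ⊗ₜ y ⊗ₜ z) = z ⊗ₜ x ⊗ₜ y := rfl

theorem cyc_cyc_cyc (w : A ⊗[k] A ⊗[k] A) : cyc k (cyc k (cyc k w)) = w := by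
  induction w with
  | zero => simp
  | add x y hx hy => simp_all
  | tmul x y => induction x <;> simp_all [TensorProduct.add_tmul]

theorem outerLeft₃_mul (a b : A) (w : A ⊗[k] A ⊗[k] A) :
    outerLeft₃ k (a * b) w = outerLeft₃ k a (outerLeft₃ k b w) := by
  induction w with
  | zero => simp
  | add x y hx hy => simp_all
  | tmul x y => induction x <;> simp_all [TensorProduct.add_tmul, mul_assoc]

theorem outerLeft₃_one (w : A ⊗[k] A ⊗[k] A) : outerLeft₃ k 1 w = w := by
  induction w with
  | zero => simp
  | add x y hx hy => simp_all
  | tmul x y => induction x <;> simp_all [TensorProduct.add_tmul]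

theorem outerRight₃_mul (a b : A) (w : A ⊗[k] A ⊗[k] A) :
    outerRight₃ k (a * b) w = outerRight₃ k b (outerRight₃ k a w) := by
  induction w <;> simp_all [mul_assoc]

theorem outerLeft₃_add (a b : A) (w : A ⊗[k] A ⊗[k] A) :
    outerLeft₃ k (a + b) w = outerLeft₃ k a w + outerLeft₃ k b w := by
  rw [outerLeft₃, show outerLeft k (a + b) = _ from map_add (outerLeftHom k) a b,
    LinearMap.rTensor_add]
  rfl

theorem outerLeft₃_smul (c : k) (b : A) (w : A ⊗[k] A ⊗[k] A) :
    outerLeft₃ k (c • b) w = c • outerLeft₃ k b w := by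
  rw [outerLeft₃, show outerLeft k (c • b) = _ from map_smul (outerLeftHom k) c b,
    LinearMap.rTensor_smul]
  rfl

theorem outerRight₃_add (a b : A) (w : A ⊗[k] A ⊗[k] A) :
    outerRight₃ k (a + b) w = outerRight₃ k a w + outerRight₃ k b w := by
  rw [outerRight₃, show LinearMap.mulRight k (a + b) = _ from map_add (LinearMap.mul k A).flip a b,
    LinearMap.lTensor_add]
  rfl

theorem outerRight₃_smul (c : k) (b : A) (w : A ⊗[k] A ⊗[k] A) :
    outerRight₃ k (c • b) w = c • outerRight₃ k b w := by
  rw [outerRight₃, show LinearMap.mulRight k (c • b) = _ from map_smul (LinearMap.mul k A).flip c b,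
    LinearMap.lTensor_smul]
  rfl

theorem outerLeft₃_outerRight₃ (a b : A) (w : A ⊗[k] A ⊗[k] A) :
    outerLeft₃ k a (outerRight₃ k b w) = outerRight₃ k b (outerLeft₃ k a w) := by
  induction w <;> simp_all

end Bimodules

/-! ### The triple bracket and the quasi-Poisson right hand side as derivations. -/

section Triple

variable {k : Type*} [Field k] {A : Type*} [Ring A] [Algebra k A]
  {D : A →ₗ[k] A →ₗ[k] A ⊗[k] A}

@[simp] theorem extend_tmul (a x y : A) : extend D a (x ⊗ₜ y) = D a x ⊗ₜ y := rfl

theorem extend_add_left (a b : A) (w : A ⊗[k] A) :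
    extend D (a + b) w = extend D a w + extend D b w := by
  simp [extend, LinearMap.rTensor_add]

theorem extend_smul_left (c : k) (b : A) (w : A ⊗[k] A) :
    extend D (c • b) w = c • extend D b w := by
  simp [extend, LinearMap.rTensor_smul]

theorem extend_eq_zero {a : A} (h : D a = 0) (w : A ⊗[k] A) : extend D a w = 0 := by
  simp [extend, h]

theorem triple_cyc (a b c : A) : cyc k (triple D a b c) = triple D c a b := by
  simp only [triple, map_add, cyc_cyc_cyc]
  abel

/-- Both sides send `u = p ⊗ q` and `w = x ⊗ y` to `p ⊗ q x ⊗ y`. They are the two cross terms in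
the Leibniz rule for the triple bracket; antisymmetry gives them opposite signs. -/
theorem rTensor_outerRightHom_flip (u w : A ⊗[k] A) :
    LinearMap.rTensor A ((LinearMap.lTensorHom A ∘ₗ (LinearMap.mul k A).flip).flip u) w =
      cyc k (LinearMap.rTensor A ((LinearMap.rTensorHom A ∘ₗ LinearMap.mul k A).flip w)
        (TensorProduct.comm k A A u)) := by
  induction u with
  | zero => simp
  | add u v hu hv => simp only [map_add, LinearMap.rTensor_add, LinearMap.add_apply, hu, hv]
  | tmul p q =>
    induction w with
    | zero => simp
    | add u v hu hv =>
      simp only [map_add, LinearMap.rTensor_add, LinearMap.add_apply, hu, hv]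
    | tmul x y => simp

namespace IsDoubleBracket

variable {I : Type*} {e : I → A}

/-- The flip of `A ⊗ A` exchanges the outer and the inner structure, so antisymmetry turns one
Leibniz rule into the other. -/
theorem mul_left (hD : IsDoubleBracket k e D) (a b c : A) :
    D (a * b) c = innerLeft k a (D b c) + innerRight k b (D a c) := by
  rw [hD.antisymm (a * b), hD.deriv, map_add, comm_outerLeft, comm_outerRight, hD.antisymm b,
    hD.antisymm a, map_neg, map_neg, neg_add_rev]

/-- Besides the expected terms, the expansion has one product of `{a, c}` with `{b, d}` from the
first summand of the triple bracket and one of `{c, a}` with `{b, d}` from the second; they cancel.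
-/
theorem triple_mul_right (hD : IsDoubleBracket k e D) (a b c d : A) :
    triple D a b (c * d) = outerRight₃ k d (triple D a b c) + outerLeft₃ k c (triple D a b d) := by
  have h₁ (w : A ⊗[k] A) : extend D a (outerRight k d w) = outerRight₃ k d (extend D a w) := by
    induction w <;> simp_all
  have h₂ (w : A ⊗[k] A) : extend D a (outerLeft k c w) = outerLeft₃ k c (extend D a w) +
      LinearMap.rTensor A ((LinearMap.lTensorHom A ∘ₗ (LinearMap.mul k A).flip).flip (D a c)) w := by
    induction w with
    | zero => simp
    | add x y hx hy => simp only [map_add, hx, hy]; abel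
    | tmul x y =>
      simp only [outerLeft_tmul, extend_tmul, hD.deriv, TensorProduct.add_tmul, outerLeft₃_tmul]
      rw [add_comm]; rfl
  have h₃ (w : A ⊗[k] A) : cyc k (extend D b (innerLeft k c w)) =
      outerLeft₃ k c (cyc k (extend D b w)) := by
    induction w with
    | zero => simp
    | add x y hx hy => simp only [map_add, hx, hy]
    | tmul x y =>
      simp only [innerLeft_tmul, extend_tmul]
      generalize D b x = u
      induction u <;> simp_all [TensorProduct.add_tmul]
  have h₄ (w : A ⊗[k] A) : cyc k (extend D b (innerRight k d w)) =
      outerRight₃ k d (cyc k (extend D b w)) +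
      cyc k (LinearMap.rTensor A ((LinearMap.rTensorHom A ∘ₗ LinearMap.mul k A).flip (D b d)) w) := by
    induction w with
    | zero => simp
    | add x y hx hy => simp only [map_add, hx, hy]; abel
    | tmul x y =>
      simp only [innerRight_tmul, extend_tmul, hD.deriv, TensorProduct.add_tmul, map_add]
      congr 1
      generalize D b x = u
      induction u <;> simp_all [TensorProduct.add_tmul]
  have h₅ (w : A ⊗[k] A) : cyc k (cyc k (extend D (c * d) w)) =
      outerLeft₃ k c (cyc k (cyc k (extend D d w))) +
      outerRight₃ k d (cyc k (cyc k (extend D c w))) := by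
    induction w with
    | zero => simp
    | add x y hx hy => simp only [map_add, hx, hy]; abel
    | tmul x y =>
      simp only [extend_tmul, hD.mul_left, TensorProduct.add_tmul, map_add]
      congr 1
      · generalize D d x = u
        induction u <;> simp_all [TensorProduct.add_tmul]
      · generalize D c x = u
        induction u <;> simp_all [TensorProduct.add_tmul]
  have h₆ := rTensor_outerRightHom_flip (D a c) (D b d)
  rw [← neg_neg (TensorProduct.comm k A A (D a c)), ← hD.antisymm, map_neg, map_neg] at h₆
  simp only [triple, hD.deriv, hD.mul_left c d a, map_add, h₁, h₂, h₃, h₄, h₅, h₆]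
  abel

end IsDoubleBracket

/-- The element `w` such that the right hand side of the quasi-Poisson identity is the sum over
`s` of `¼ (c w - w c)`. -/
def gaugeTerm (e a b : A) : A ⊗[k] A ⊗[k] A :=
  (e * a) ⊗ₜ (e * b) ⊗ₜ e - (e * a) ⊗ₜ e ⊗ₜ (b * e) - e ⊗ₜ (a * e * b) ⊗ₜ e
    + e ⊗ₜ (a * e) ⊗ₜ (b * e)

variable (k) in
/-- The right hand side of the quasi-Poisson identity. -/
def quasiTerm {I : Type*} [Fintype I] (e : I → A) (a b c : A) : A ⊗[k] A ⊗[k] A :=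
  (1 / 4 : k) • ∑ s : I,
    ((c * e s * a) ⊗ₜ[k] (e s * b) ⊗ₜ[k] e s
      - (c * e s * a) ⊗ₜ[k] e s ⊗ₜ[k] (b * e s)
      - (c * e s) ⊗ₜ[k] (a * e s * b) ⊗ₜ[k] e s
      + (c * e s) ⊗ₜ[k] (a * e s) ⊗ₜ[k] (b * e s)
      - (e s * a) ⊗ₜ[k] (e s * b) ⊗ₜ[k] (e s * c)
      + (e s * a) ⊗ₜ[k] e s ⊗ₜ[k] (b * e s * c)
      + e s ⊗ₜ[k] (a * e s * b) ⊗ₜ[k] (e s * c)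
      - e s ⊗ₜ[k] (a * e s) ⊗ₜ[k] (b * e s * c))

variable {I : Type*} [Fintype I] (e : I → A)

theorem quasiTerm_eq (a b c : A) : quasiTerm k e a b c =
    (1 / 4 : k) • ∑ s : I, (outerLeft₃ k c (gaugeTerm (e s) a b)
      - outerRight₃ k c (gaugeTerm (e s) a b)) := by
  rw [quasiTerm]
  congr 1
  refine Finset.sum_congr rfl fun s _ => ?_
  simp only [gaugeTerm, map_add, map_sub, outerLeft₃_tmul, outerLeft_tmul, outerRight₃_tmul,
    mul_assoc]
  abel

theorem quasiTerm_cyc (a b c : A) : cyc k (quasiTerm k e a b c) = quasiTerm k e c a b := by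
  simp only [quasiTerm, map_smul, map_sum, map_add, map_sub, cyc_tmul]
  congr 1
  refine Finset.sum_congr rfl fun s _ => ?_
  abel

theorem quasiTerm_mul_right (a b c d : A) : quasiTerm k e a b (c * d) =
    outerRight₃ k d (quasiTerm k e a b c) + outerLeft₃ k c (quasiTerm k e a b d) := by
  simp only [quasiTerm_eq, map_smul, map_sum, map_sub, ← smul_add, ← Finset.sum_add_distrib,
    outerLeft₃_mul, outerRight₃_mul, outerLeft₃_outerRight₃]
  congr 1
  refine Finset.sum_congr rfl fun s _ => ?_
  abel

/-- Every term of `gaugeTerm (e s) a b` starts and ends with `e s`. Hence `e t` acts from both sides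
as the identity if `s = t` and as zero otherwise, and the commutator vanishes. -/
theorem quasiTerm_base (he : OrthogonalIdempotents e) (a b : A) (t : I) :
    quasiTerm k e a b (e t) = 0 := by
  classical
  rw [quasiTerm_eq, Finset.sum_eq_zero, smul_zero]
  intro s _
  have h := he.mul_eq t s
  have h' := he.mul_eq s t
  rcases eq_or_ne t s with rfl | hts
  · simp only [if_true] at h
    simp [gaugeTerm, ← mul_assoc, h]
    simp [mul_assoc, h]
  · rw [if_neg hts] at h
    rw [if_neg hts.symm] at h'
    simp [gaugeTerm, ← mul_assoc, h, h']
    simp [mul_assoc, h']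

end Triple

end DoubleBracket

/-! ### Universal properties and induction principles of the localisation and the path algebra. -/

namespace UnivLoc

variable {k : Type*} [Field k] {R : Type*} [Ring R] [Algebra k R] {S : Set R}
  {T : Type*} [Ring T] [Algebra k T]

/-- A homomorphism inverting the elements of `S` extends to the universal localisation. -/
theorem exists_lift (f : R →ₐ[k] T) (hf : ∀ s : S, IsUnit (f s)) :
    ∃ g : UnivLoc k S →ₐ[k] T, ∀ r, g (of k S r) = f r := by
  refine ⟨RingQuot.liftAlgHom k ⟨FreeAlgebra.lift k
    (Sum.elim f fun s => ((hf s).unit⁻¹ : Tˣ)), ?_⟩, fun r => ?_⟩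
  · intro x y h
    cases h with
    | add r r' => simp
    | mul r r' => simp
    | scalar c => simp
    | mul_inv s => simp
    | inv_mul s => simp
  · change RingQuot.liftAlgHom k _ (RingQuot.mkAlgHom k (UnivLocRel k S) _) = _
    rw [RingQuot.liftAlgHom_mkAlgHom_apply]
    simp

theorem induction {C : UnivLoc k S → Prop} (hof : ∀ r, C (of k S r))
    (hadd : ∀ x y, C x → C y → C (x + y)) (hmul : ∀ x y, C x → C y → C (x * y))
    (hinv : ∀ x y, x * y = 1 → y * x = 1 → C x → C y) (x : UnivLoc k S) : C x := by
  obtain ⟨w, rfl⟩ : ∃ w, mk k S w = x := RingQuot.mkAlgHom_surjective k (UnivLocRel k S) x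
  induction w using FreeAlgebra.induction with
  | grade0 c =>
    rw [AlgHom.commutes, ← AlgHom.commutes (of k S)]
    exact hof _
  | grade1 x =>
    cases x with
    | inl r => exact hof r
    | inr s => exact hinv _ _ (of_mul_inv k S s) (inv_mul_of k S s) (hof s)
  | mul x y hx hy => rw [map_mul]; exact hmul _ _ hx hy
  | add x y hx hy => rw [map_add]; exact hadd _ _ hx hy

end UnivLoc

namespace ArrowQuiver

section Double

variable {I Q : Type*} {G : ArrowQuiver I Q}

@[simp] theorem star_star (a : Q ⊕ Q) : star (star a) = a := Sum.swap_swap a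

theorem star_ne (a : Q ⊕ Q) : star a ≠ a := by cases a <;> simp [star]

theorem star_eq_iff (a b : Q ⊕ Q) : star a = b ↔ a = star b := by
  cases a <;> cases b <;> simp [star]

@[simp] theorem head_double (a : Q ⊕ Q) : G.double.head a = G.double.tail (star a) := by
  cases a <;> rfl

@[simp] theorem gammaBar_star {k : Type*} {γ : Q → k} (a : Q ⊕ Q) :
    gammaBar γ (star a) = gammaBar γ a := by
  cases a <;> rfl

end Double

namespace PathAlgebra

variable {k : Type*} [Field k] {I Q : Type*} [Fintype I] {G : ArrowQuiver I Q}
  {T : Type*} [Ring T] [Algebra k T]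

theorem exists_lift (v : I → T) (w : Q → T) (hv : CompleteOrthogonalIdempotents v)
    (hw : ∀ a, w a = v (G.tail a) * w a * v (G.head a)) :
    ∃ f : PathAlgebra k G →ₐ[k] T, (∀ s, f (vertex k G s) = v s) ∧ ∀ a, f (arrow k G a) = w a := by
  refine ⟨RingQuot.liftAlgHom k ⟨FreeAlgebra.lift k (Sum.elim v w), ?_⟩, fun s => ?_, fun a => ?_⟩
  · intro x y h
    cases h with
    | idem s => simpa using (hv.idem s).eq
    | orth s t h => simpa using hv.ortho h
    | complete => simpa using hv.complete
    | arrow a => simpa using hw a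
  · change RingQuot.liftAlgHom k _ (RingQuot.mkAlgHom k (PathRel k G) _) = _
    rw [RingQuot.liftAlgHom_mkAlgHom_apply]
    simp
  · change RingQuot.liftAlgHom k _ (RingQuot.mkAlgHom k (PathRel k G) _) = _
    rw [RingQuot.liftAlgHom_mkAlgHom_apply]
    simp

theorem induction {C : PathAlgebra k G → Prop} (hscalar : ∀ c, C (algebraMap k _ c))
    (hvertex : ∀ s, C (vertex k G s)) (harrow : ∀ a, C (arrow k G a))
    (hadd : ∀ x y, C x → C y → C (x + y)) (hmul : ∀ x y, C x → C y → C (x * y))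
    (x : PathAlgebra k G) : C x := by
  obtain ⟨w, rfl⟩ : ∃ w, mk k G w = x := RingQuot.mkAlgHom_surjective k (PathRel k G) x
  induction w using FreeAlgebra.induction with
  | grade0 c => rw [AlgHom.commutes]; exact hscalar c
  | grade1 x =>
    cases x with
    | inl s => exact hvertex s
    | inr a => exact harrow a
  | mul x y hx hy => rw [map_mul]; exact hmul _ _ hx hy
  | add x y hx hy => rw [map_add]; exact hadd _ _ hx hy

end PathAlgebra

/-! ### Derivations of the localised path algebra. -/

section Localised

variable {k : Type*} [Field k] {I Q : Type*} [Fintype I] {G : ArrowQuiver I Q} {γ : Q → k}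

theorem arr_mul_e_star (a : Q ⊕ Q) : arr G γ a * e G γ (G.double.tail (star a)) = arr G γ a := by
  simpa using arr_mul_e G γ (star a)

theorem LocAlgebra.induction {C : LocAlgebra G γ → Prop}
    (hscalar : ∀ c, C (algebraMap k _ c))
    (he : ∀ s, C (e G γ s)) (harr : ∀ a, C (arr G γ a))
    (hadd : ∀ x y, C x → C y → C (x + y)) (hmul : ∀ x y, C x → C y → C (x * y))
    (hinv : ∀ x y, x * y = 1 → y * x = 1 → C x → C y) (x : LocAlgebra G γ) : C x := by
  refine UnivLoc.induction (fun r => ?_) hadd hmul hinv x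
  induction r using PathAlgebra.induction with
  | hscalar c => rw [AlgHom.commutes]; exact hscalar c
  | hvertex s => exact he s
  | harrow a => exact harr a
  | hadd x y hx hy => rw [map_add]; exact hadd _ _ hx hy
  | hmul x y hx hy => rw [map_mul]; exact hmul _ _ hx hy

theorem exists_lift {T : Type*} [Ring T] [Algebra k T] (v : I → T) (w : Q ⊕ Q → T)
    (hv : CompleteOrthogonalIdempotents v)
    (hw : ∀ a, w a = v (G.double.tail a) * w a * v (G.double.tail (star a)))
    (hunit : ∀ a, IsUnit (1 + (gammaBar γ a - 1) • v (G.double.tail a) + w a * w (star a))) :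
    ∃ f : LocAlgebra G γ →ₐ[k] T, (∀ s, f (e G γ s) = v s) ∧ ∀ a, f (arr G γ a) = w a := by
  obtain ⟨f, hfv, hfw⟩ := PathAlgebra.exists_lift (k := k) (G := G.double) v w hv
    (fun a => by rw [head_double]; exact hw a)
  obtain ⟨g, hg⟩ := UnivLoc.exists_lift (S := Set.range (locElt G γ)) f (by
    rintro ⟨_, a, rfl⟩
    simpa [locElt, hfv, hfw] using hunit a)
  exact ⟨g, fun s => (hg _).trans (hfv s), fun a => (hg _).trans (hfw a)⟩

theorem algHom_ext {T : Type*} [Ring T] [Algebra k T] {f g : LocAlgebra G γ →ₐ[k] T}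
    (he : ∀ s, f (e G γ s) = g (e G γ s)) (harr : ∀ a, f (arr G γ a) = g (arr G γ a)) : f = g := by
  refine AlgHom.ext fun x => ?_
  induction x using LocAlgebra.induction with
  | hscalar c => simp
  | he s => exact he s
  | harr a => exact harr a
  | hadd x y hx hy => simp [hx, hy]
  | hmul x y hx hy => simp [hx, hy]
  | hinv x y hxy hyx hx =>
    refine left_inv_eq_right_inv (a := f x) ?_ ?_
    · rw [← map_mul, hyx, map_one]
    · rw [hx, ← map_mul, hxy, map_one]

variable {M : Type*} [AddCommGroup M] [Module k M]

/-- A derivation vanishing on the idempotents and on the arrows is zero. -/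
theorem derivation_eq_zero (L R : LocAlgebra G γ → M →ₗ[k] M)
    (hL : ∀ a b m, L (a * b) m = L a (L b m)) (hL₁ : ∀ m, L 1 m = m)
    (d : LocAlgebra G γ → M) (hadd : ∀ x y, d (x + y) = d x + d y)
    (hsmul : ∀ (c : k) x, d (c • x) = c • d x)
    (hmul : ∀ x y, d (x * y) = R y (d x) + L x (d y))
    (he : ∀ s, d (e G γ s) = 0) (harr : ∀ a, d (arr G γ a) = 0) (x : LocAlgebra G γ) :
    d x = 0 := by
  have h₁ : d 1 = 0 := by
    rw [← (e_completeOrthogonalIdempotents G γ).complete]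
    exact (map_sum (AddMonoidHom.mk' d hadd) _ _).trans (Finset.sum_eq_zero fun s _ => he s)
  induction x using LocAlgebra.induction with
  | hscalar c => rw [Algebra.algebraMap_eq_smul_one, hsmul, h₁, smul_zero]
  | he s => exact he s
  | harr a => exact harr a
  | hadd x y hx hy => rw [hadd, hx, hy, add_zero]
  | hmul x y hx hy => rw [hmul, hx, hy, map_zero, map_zero, add_zero]
  | hinv x y hxy hyx hx =>
    -- Applying `d` to `x y = 1` leaves `x · d y = 0`, and acting by `y` gives `d y = 0`.
    have h := hmul x y
    rw [hxy, h₁, hx, map_zero, zero_add] at h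
    rw [← hL₁ (d y), ← hyx, hL, ← h, map_zero]

/-- Derivations with prescribed values on the arrows exist. -/
theorem exists_derivation (L : LocAlgebra G γ →ₐ[k] Module.End k M)
    (R : (LocAlgebra G γ)ᵐᵒᵖ →ₐ[k] Module.End k M)
    (hLR : ∀ a b m, L a (R b m) = R b (L a m)) (v : Q ⊕ Q → M)
    (hvL : ∀ a, L (e G γ (G.double.tail a)) (v a) = v a)
    (hvR : ∀ a, R (.op (e G γ (G.double.tail (star a)))) (v a) = v a) :
    ∃ d : LocAlgebra G γ →ₗ[k] M, (∀ x y, d (x * y) = R (.op y) (d x) + L x (d y)) ∧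
      (∀ s, d (e G γ s) = 0) ∧ ∀ a, d (arr G γ a) = v a := by
  let : Module (LocAlgebra G γ) M := Module.compHom M L.toRingHom
  let : Module (LocAlgebra G γ)ᵐᵒᵖ M := Module.compHom M R.toRingHom
  have hl (a : LocAlgebra G γ) (m : M) : a • m = L a m := rfl
  have hr (a : (LocAlgebra G γ)ᵐᵒᵖ) (m : M) : a • m = R a m := rfl
  have : SMulCommClass (LocAlgebra G γ) (LocAlgebra G γ)ᵐᵒᵖ M := ⟨fun a b m => hLR a b m⟩
  have : IsScalarTower k (LocAlgebra G γ) M := ⟨fun c a m => by simp [hl]⟩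
  have : IsScalarTower k (LocAlgebra G γ)ᵐᵒᵖ M := ⟨fun c a m => by simp [hr]⟩
  have hce := e_completeOrthogonalIdempotents G γ
  -- An algebra map `x ↦ (x, d x)` into the square-zero extension is the same as a derivation `d`.
  -- The corner conditions on `v` are the arrow relations in the second component.
  obtain ⟨f, hfe, hfa⟩ := exists_lift (G := G) (γ := γ)
    (T := TrivSqZeroExt (LocAlgebra G γ) M)
    (fun s => TrivSqZeroExt.inl (e G γ s))
    (fun a => TrivSqZeroExt.inl (arr G γ a) + TrivSqZeroExt.inr (v a))
    { idem := fun s => by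
        change TrivSqZeroExt.inl _ * TrivSqZeroExt.inl _ = _
        rw [← TrivSqZeroExt.inl_mul, hce.idem s]
      ortho := fun s t h => by
        change TrivSqZeroExt.inl _ * TrivSqZeroExt.inl _ = _
        rw [← TrivSqZeroExt.inl_mul]
        exact congrArg _ (hce.ortho h)
      complete := by
        rw [← TrivSqZeroExt.inl_one, ← hce.complete]
        exact (map_sum (TrivSqZeroExt.inlHom (LocAlgebra G γ) M) _ _).symm }
    (fun a => by
      ext
      · simp [e_mul_arr, arr_mul_e_star]
      · simp [hl, hr, hvL, hvR])
    (fun a => by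
      -- The kernel `M` squares to zero, so invertibility is only a condition in `A`, where it holds
      -- by construction.
      rw [TrivSqZeroExt.isUnit_iff_isUnit_fst]
      simp only [TrivSqZeroExt.fst_add, TrivSqZeroExt.fst_one, TrivSqZeroExt.fst_smul,
        TrivSqZeroExt.fst_inl, TrivSqZeroExt.fst_mul, TrivSqZeroExt.fst_inr, add_zero]
      rw [← of_locElt]
      let s : Set.range (locElt G γ) := ⟨locElt G γ a, a, rfl⟩
      exact ⟨⟨_, _, UnivLoc.of_mul_inv k _ s, UnivLoc.inv_mul_of k _ s⟩, rfl⟩)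
  have hfst : (TrivSqZeroExt.fstHom k (LocAlgebra G γ) M).comp f = AlgHom.id k _ :=
    algHom_ext (fun s => by simp [hfe]) (fun a => by simp [hfa])
  have hfst' (x) : (f x).fst = x := DFunLike.congr_fun hfst x
  refine ⟨(TrivSqZeroExt.sndHom (LocAlgebra G γ) M).restrictScalars k ∘ₗ f.toLinearMap, ?_, ?_, ?_⟩
  · intro x y
    simp [hfst', hl, hr, add_comm]
  · intro s
    simp [hfe]
  · intro a
    simp [hfa]

end Localised

end ArrowQuiver

namespace ArrowQuiver

/-! ### The ordering signs. -/

section OrderSign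

variable {I Q : Type*} {G : ArrowQuiver I Q} (ord : ∀ s, LinearOrder (G.double.ArrowsFrom s))

variable (G) in
/-- The ordering function on arrows of the double with the same tail. -/
def endSign (x y : Q ⊕ Q) : ℤ := G.double.orderSign ord (G.double.tail x) x y

theorem endSign_of_ne {x y : Q ⊕ Q} (h : G.double.tail x ≠ G.double.tail y) :
    G.endSign ord x y = 0 := by
  rw [endSign, orderSign, dif_neg (fun h' => h h'.2.symm)]

theorem endSign_of_lt {s : I} {x y : G.double.ArrowsFrom s} (h : (ord s).lt x y) :
    G.endSign ord x y = 1 := by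
  obtain ⟨x, rfl⟩ := x
  simp [endSign, orderSign, y.2, h]

theorem endSign_of_gt {s : I} {x y : G.double.ArrowsFrom s} (h : (ord s).lt y x) :
    G.endSign ord x y = -1 := by
  obtain ⟨x, rfl⟩ := x
  let := ord (G.double.tail x)
  have h' : ¬ (ord (G.double.tail x)).lt ⟨x, rfl⟩ y := lt_asymm (α := G.double.ArrowsFrom _) h
  simp [endSign, orderSign, y.2, h, h']

@[simp] theorem endSign_self (x : Q ⊕ Q) : G.endSign ord x x = 0 := by
  let := ord (G.double.tail x)
  simp [endSign, orderSign]

theorem endSign_swap (x y : Q ⊕ Q) : G.endSign ord x y = -G.endSign ord y x := by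
  by_cases h : G.double.tail x = G.double.tail y
  · obtain ⟨s, hs⟩ : ∃ s, G.double.tail y = s := ⟨_, rfl⟩
    obtain ⟨x, rfl⟩ : ∃ x' : G.double.ArrowsFrom s, x'.1 = x := ⟨⟨x, h.trans hs⟩, rfl⟩
    obtain ⟨y, rfl⟩ : ∃ y' : G.double.ArrowsFrom s, y'.1 = y := ⟨⟨y, hs⟩, rfl⟩
    let := ord s
    rcases lt_trichotomy x y with h | rfl | h
    · rw [endSign_of_lt ord h, endSign_of_gt ord h]; rfl
    · simp
    · rw [endSign_of_lt ord h, endSign_of_gt ord h]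
  · rw [endSign_of_ne ord h, endSign_of_ne ord (Ne.symm h), neg_zero]

/-- For distinct elements the three signs around the cycle are `σ, σ, -σ` in some order, so the sum
is `1 - 1 - 1`. If exactly two elements coincide, one sign is zero and the other two are opposite.
-/
theorem endSign_cyclic {x y z : Q ⊕ Q} (hxy : G.double.tail x = G.double.tail y)
    (hyz : G.double.tail y = G.double.tail z) (hne : ¬ (x = y ∧ y = z)) :
    G.endSign ord x y * G.endSign ord y z + G.endSign ord y z * G.endSign ord z x
      + G.endSign ord z x * G.endSign ord x y = -1 := by
  obtain ⟨s, hs⟩ : ∃ s, G.double.tail z = s := ⟨_, rfl⟩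
  obtain ⟨x, rfl⟩ : ∃ x' : G.double.ArrowsFrom s, x'.1 = x := ⟨⟨x, hxy.trans (hyz.trans hs)⟩, rfl⟩
  obtain ⟨y, rfl⟩ : ∃ x' : G.double.ArrowsFrom s, x'.1 = y := ⟨⟨y, hyz.trans hs⟩, rfl⟩
  obtain ⟨z, rfl⟩ : ∃ x' : G.double.ArrowsFrom s, x'.1 = z := ⟨⟨z, hs⟩, rfl⟩
  let := ord s
  have key (x y : G.double.ArrowsFrom s) : x < y ∧ G.endSign ord x y = 1 ∨
      x = y ∨ y < x ∧ G.endSign ord x y = -1 := by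
    rcases lt_trichotomy x y with h | h | h
    · exact .inl ⟨h, endSign_of_lt ord h⟩
    · exact .inr (.inl h)
    · exact .inr (.inr ⟨h, endSign_of_gt ord h⟩)
  have hzx := endSign_swap ord z x
  rw [hzx]
  rcases key x y with ⟨h₁, h₁'⟩ | rfl | ⟨h₁, h₁'⟩
  · rcases key y z with ⟨h₂, h₂'⟩ | rfl | ⟨h₂, h₂'⟩
    · rw [h₁', h₂', endSign_of_lt ord (h₁.trans h₂)]; rfl
    · rw [h₁', endSign_self]; rfl
    · rw [h₁', h₂']; ring
  · rcases key x z with ⟨h₂, h₂'⟩ | rfl | ⟨h₂, h₂'⟩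
    · rw [h₂', endSign_self]; rfl
    · exact absurd ⟨rfl, rfl⟩ hne
    · rw [h₂', endSign_self]; rfl
  · rcases key y z with ⟨h₂, h₂'⟩ | rfl | ⟨h₂, h₂'⟩
    · rw [h₁', h₂']; ring
    · rw [h₁', endSign_self]; rfl
    · rw [h₁', h₂', endSign_of_gt ord (h₂.trans h₁)]; rfl

end OrderSign

open DoubleBracket

/-! ### The bracket of two arrows and its extension to the whole algebra. -/

section Sign

variable {k : Type*} [Field k] {Q : Type*}

/-- The sign which is `1` on `Q` and `-1` on the opposite arrows. -/
def arrowSign : Q ⊕ Q → k := Sum.elim 1 (-1)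

theorem arrowSign_star (b : Q ⊕ Q) : (arrowSign (star b) : k) = -arrowSign b := by
  cases b <;> simp [arrowSign, star]

end Sign

section Values

variable {k : Type*} [Field k] {I Q : Type*} [Fintype I] (G : ArrowQuiver I Q) (γ : Q → k)
  (ord : ∀ s, LinearOrder (G.double.ArrowsFrom s))

/-- The idempotent at the tail of an arrow of the double. -/
def endIdem (x : Q ⊕ Q) : LocAlgebra G γ := e G γ (G.double.tail x)

local notation "E" => endIdem G γ
local notation "X" => arr G γ

@[simp] theorem endIdem_mul_arr (x : Q ⊕ Q) : E x * X x = X x := e_mul_arr G γ x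
@[simp] theorem arr_mul_endIdem (x : Q ⊕ Q) : X x * E (star x) = X x := arr_mul_e_star x
@[simp] theorem arr_star_mul_endIdem (x : Q ⊕ Q) : X (star x) * E x = X (star x) := arr_mul_e G γ x
@[simp] theorem endIdem_mul_self (x : Q ⊕ Q) : E x * E x = E x := e_idem G γ _
@[simp] theorem endIdem_mul_arr_mul (x : Q ⊕ Q) (y : LocAlgebra G γ) :
    E x * (X x * y) = X x * y := by rw [← mul_assoc, endIdem_mul_arr]

/-- This permits replacing `E x` by `E y` in every term weighted by the sign of `x` and `y`. -/
theorem endSign_eq_zero_or (x y : Q ⊕ Q) : G.endSign ord x y = 0 ∨ E x = E y := by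
  by_cases h : G.double.tail x = G.double.tail y
  · exact .inr (by rw [endIdem, endIdem, h])
  · exact .inl (endSign_of_ne ord h)

/-- The part of the bracket of two arrows which depends on the orderings. -/
def fusionValue (b c : Q ⊕ Q) : LocAlgebra G γ ⊗[k] LocAlgebra G γ :=
  -((1 / 2 * G.endSign ord b c : k) • (X b ⊗ₜ X c))
    - (1 / 2 * G.endSign ord (star b) (star c) : k) • (X c ⊗ₜ X b)
    + (1 / 2 * G.endSign ord b (star c) : k) • ((X c * X b) ⊗ₜ E b)
    + (1 / 2 * G.endSign ord (star b) c : k) • (E (star b) ⊗ₜ (X b * X c))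

/-- The bracket of `b` and `b*` for the quiver with all vertices separated. -/
def pairValue (b : Q ⊕ Q) : LocAlgebra G γ ⊗[k] LocAlgebra G γ :=
  (arrowSign b : k) • (gammaBar γ b • (E (star b) ⊗ₜ E b)
    + (1 / 2 : k) • ((X (star b) * X b) ⊗ₜ E b) + (1 / 2 : k) • (E (star b) ⊗ₜ (X b * X (star b))))

open Classical in
/-- The bracket of two arrows. -/
def arrowValue (b c : Q ⊕ Q) : LocAlgebra G γ ⊗[k] LocAlgebra G γ :=
  fusionValue G γ ord b c + if c = star b then pairValue G γ b else 0

theorem fusionValue_swap (b c : Q ⊕ Q) :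
    fusionValue G γ ord b c = -TensorProduct.comm k _ _ (fusionValue G γ ord c b) := by
  simp only [fusionValue, map_add, map_sub, map_neg, map_smul, TensorProduct.comm_tmul,
    endSign_swap ord c b, endSign_swap ord (star c) (star b), endSign_swap ord c (star b),
    endSign_swap ord (star c) b, Int.cast_neg]
  rcases endSign_eq_zero_or G γ ord b (star c) with h₁ | h₁ <;>
  rcases endSign_eq_zero_or G γ ord (star b) c with h₂ | h₂ <;>
  simp only [h₁, h₂, Int.cast_zero] <;> module

theorem pairValue_swap (b : Q ⊕ Q) :
    pairValue G γ (star b) = -TensorProduct.comm k _ _ (pairValue G γ b) := by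
  simp only [pairValue, map_add, map_smul, TensorProduct.comm_tmul, arrowSign_star, star_star,
    gammaBar_star]
  module

theorem arrowValue_swap (b c : Q ⊕ Q) :
    arrowValue G γ ord b c = -TensorProduct.comm k _ _ (arrowValue G γ ord c b) := by
  rw [arrowValue, arrowValue, fusionValue_swap, map_add, neg_add]
  congr 1
  split_ifs with h₁ h₂ h₂
  · rw [h₁, pairValue_swap]; simp
  · simp [h₁] at h₂
  · simp [h₂] at h₁
  · simp

/-- This and the next three lemmas place the value in the corners of `A ⊗ A` required by
`exists_derivation`: the outer ones for the second argument, the inner ones for the first. -/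
theorem outerLeft_arrowValue (b c : Q ⊕ Q) :
    outerLeft k (E c) (arrowValue G γ ord b c) = arrowValue G γ ord b c := by
  have h : outerLeft k (E c) (fusionValue G γ ord b c) = fusionValue G γ ord b c := by
    simp only [fusionValue, map_add, map_sub, map_neg, map_smul, outerLeft_tmul,
      endIdem_mul_arr, endIdem_mul_arr_mul]
    have h₁ : G.endSign ord b c = 0 ∨ E c * X b = X b :=
      (endSign_eq_zero_or G γ ord b c).imp_right fun h => by rw [← h, endIdem_mul_arr]
    have h₂ : G.endSign ord (star b) c = 0 ∨ E c * E (star b) = E (star b) :=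
      (endSign_eq_zero_or G γ ord (star b) c).imp_right fun h => by rw [h, endIdem_mul_self]
    rcases h₁ with h₁ | h₁ <;> rcases h₂ with h₂ | h₂ <;> simp [h₁, h₂]
  rw [arrowValue, map_add, h]
  split_ifs with hc
  · simp [hc, pairValue]
  · simp

theorem outerRight_arrowValue (b c : Q ⊕ Q) :
    outerRight k (E (star c)) (arrowValue G γ ord b c) = arrowValue G γ ord b c := by
  have h : outerRight k (E (star c)) (fusionValue G γ ord b c) = fusionValue G γ ord b c := by
    simp only [fusionValue, map_add, map_sub, map_neg, map_smul, outerRight_tmul, mul_assoc,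
      arr_mul_endIdem]
    have h₁ : G.endSign ord (star b) (star c) = 0 ∨ X b * E (star c) = X b :=
      (endSign_eq_zero_or G γ ord _ _).imp_right fun h => by rw [← h, arr_mul_endIdem]
    have h₂ : G.endSign ord b (star c) = 0 ∨ E b * E (star c) = E b :=
      (endSign_eq_zero_or G γ ord b (star c)).imp_right fun h => by rw [← h, endIdem_mul_self]
    rcases h₁ with h₁ | h₁ <;> rcases h₂ with h₂ | h₂ <;> simp [h₁, h₂]
  rw [arrowValue, map_add, h]
  split_ifs with hc
  · simp [hc, pairValue, mul_assoc]
  · simp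

theorem innerLeft_arrowValue (b c : Q ⊕ Q) :
    innerLeft k (E b) (arrowValue G γ ord b c) = arrowValue G γ ord b c := by
  rw [arrowValue_swap, map_neg, ← comm_outerLeft, outerLeft_arrowValue]

theorem innerRight_arrowValue (b c : Q ⊕ Q) :
    innerRight k (E (star b)) (arrowValue G γ ord b c) = arrowValue G γ ord b c := by
  rw [arrowValue_swap, map_neg, ← comm_outerRight, outerRight_arrowValue]

variable {G γ ord} in
/-- Bilinear maps which are derivations in both arguments agree if they agree on arrows. -/
theorem bracket_ext
    {D D' : LocAlgebra G γ →ₗ[k] LocAlgebra G γ →ₗ[k] LocAlgebra G γ ⊗[k] LocAlgebra G γ}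
    (hl : ∀ a b c, D (a * b) c = innerLeft k a (D b c) + innerRight k b (D a c))
    (hl' : ∀ a b c, D' (a * b) c = innerLeft k a (D' b c) + innerRight k b (D' a c))
    (hr : ∀ a b c, D (X a) (b * c) = outerRight k c (D (X a) b) + outerLeft k b (D (X a) c))
    (hr' : ∀ a b c, D' (X a) (b * c) = outerRight k c (D' (X a) b) + outerLeft k b (D' (X a) c))
    (he : ∀ s c, D (e G γ s) c = 0) (he' : ∀ s c, D' (e G γ s) c = 0)
    (her : ∀ a s, D (X a) (e G γ s) = 0) (her' : ∀ a s, D' (X a) (e G γ s) = 0)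
    (h : ∀ a b, D (X a) (X b) = D' (X a) (X b)) : D = D' := by
  refine LinearMap.ext fun x => LinearMap.ext fun y => sub_eq_zero.1 ?_
  refine derivation_eq_zero (G := G) (γ := γ) (innerLeft k) (innerRight k) (innerLeft_mul k)
    (innerLeft_one k) (fun x => D x y - D' x y) ?_ ?_ ?_ ?_ (fun a => ?_) x
  · intro x y; simp only [map_add, LinearMap.add_apply]; abel
  · intro c x; simp [smul_sub]
  · intro x y; simp only [hl, hl', map_sub]; abel
  · intro s; rw [he, he', sub_zero]
  · refine derivation_eq_zero (G := G) (γ := γ) (outerLeft k) (outerRight k)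
      (fun a b m => LinearMap.congr_fun (map_mul (outerLeftHom k) a b) m)
      (fun m => LinearMap.congr_fun (map_one (outerLeftHom k)) m)
      (fun y => D (X a) y - D' (X a) y) ?_ ?_ ?_ ?_ (fun b => ?_) y
    · intro x y; simp only [map_add]; abel
    · intro c x; simp [smul_sub]
    · intro x y; simp only [hr, hr', map_sub]; abel
    · intro s; rw [her, her', sub_zero]
    · rw [h, sub_self]

theorem exists_arrow_derivation (a : Q ⊕ Q) :
    ∃ d : LocAlgebra G γ →ₗ[k] LocAlgebra G γ ⊗[k] LocAlgebra G γ,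
      (∀ x y, d (x * y) = outerRight k y (d x) + outerLeft k x (d y)) ∧
      (∀ s, d (e G γ s) = 0) ∧ ∀ b, d (X b) = arrowValue G γ ord a b :=
  exists_derivation (outerLeftHom k) (outerRightHom k)
    (fun a b m => outerLeft_outerRight k a b.unop m) _ (outerLeft_arrowValue G γ ord a)
    (outerRight_arrowValue G γ ord a)

/-- Each arrow `a` gives a derivation `d a` for the outer structure; then `a ↦ d a` extends to a
derivation with values in `Hom(A, A ⊗ A)`, on which `A` acts through the inner structure. The rule
in the second argument and antisymmetry spread from the arrows by uniqueness. -/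
theorem exists_doubleBracket :
    ∃ D : LocAlgebra G γ →ₗ[k] LocAlgebra G γ →ₗ[k] LocAlgebra G γ ⊗[k] LocAlgebra G γ,
      IsDoubleBracket k (e G γ) D ∧ ∀ a b, D (X a) (X b) = arrowValue G γ ord a b := by
  choose d hd hde hda using exists_arrow_derivation G γ ord
  -- The second extension needs the corner conditions for the maps `d a` themselves. If `φ` commutes
  -- with the outer actions, `φ ∘ d a` is again a derivation, so the comparison on arrows suffices.
  have hinv (a : Q ⊕ Q) (φ : Module.End k (LocAlgebra G γ ⊗[k] LocAlgebra G γ))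
      (hl : ∀ x w, outerLeft k x (φ w) = φ (outerLeft k x w))
      (hr : ∀ x w, outerRight k x (φ w) = φ (outerRight k x w))
      (hφ : ∀ b, φ (arrowValue G γ ord a b) = arrowValue G γ ord a b) : φ ∘ₗ d a = d a := by
    refine LinearMap.ext fun x => sub_eq_zero.1 ?_
    refine derivation_eq_zero (G := G) (γ := γ) (outerLeft k) (outerRight k)
      (fun a b m => LinearMap.congr_fun (map_mul (outerLeftHom k) a b) m)
      (fun m => LinearMap.congr_fun (map_one (outerLeftHom k)) m)
      (fun x => φ (d a x) - d a x) ?_ ?_ ?_ ?_ ?_ x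
    · intro x y; simp only [map_add]; abel
    · intro c x; simp [smul_sub]
    · intro x y; simp only [hd, map_add, map_sub, hl, hr]; abel
    · intro s; simp [hde]
    · intro b; rw [hda, hφ, sub_self]
  obtain ⟨D, hD, hDe, hDa⟩ := exists_derivation (G := G) (γ := γ) (innerLeftHom k)
    (innerRightHom k)
    (fun a b m => LinearMap.ext fun x => innerLeft_innerRight k a b.unop (m x)) d
    (fun a => hinv a _ (fun x => outerLeft_innerLeft k x _) (fun x => outerRight_innerLeft k x _)
      (innerLeft_arrowValue G γ ord a))
    (fun a => hinv a _ (fun x => outerLeft_innerRight k x _) (fun x => outerRight_innerRight k x _)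
      (innerRight_arrowValue G γ ord a))
  have hl (a b c : LocAlgebra G γ) :
      D (a * b) c = innerLeft k a (D b c) + innerRight k b (D a c) := by
    rw [hD, add_comm]; rfl
  have hr (x y z : LocAlgebra G γ) :
      D x (y * z) = outerRight k z (D x y) + outerLeft k y (D x z) := by
    -- Since inner and outer actions commute, the failure of the second Leibniz rule is a derivation
    -- in `x`; it vanishes on arrows because each `d a` is a derivation.
    refine sub_eq_zero.1 ?_
    refine derivation_eq_zero (G := G) (γ := γ) (innerLeft k) (innerRight k) (innerLeft_mul k)
      (innerLeft_one k)
      (fun x => D x (y * z) - (outerRight k z (D x y) + outerLeft k y (D x z))) ?_ ?_ ?_ ?_ ?_ x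
    · intro x y; simp only [map_add, LinearMap.add_apply]; abel
    · intro c x; simp [smul_sub]
    · intro x y
      simp only [hl, map_add, map_sub, outerLeft_innerLeft, outerLeft_innerRight,
        outerRight_innerLeft, outerRight_innerRight]
      abel
    · intro s; simp [hDe]
    · intro b; simp [hDa, hd]
  have her (a : Q ⊕ Q) (s : I) : D (X a) (e G γ s) = 0 := by rw [hDa, hde]
  have hDaa (a b : Q ⊕ Q) : D (X a) (X b) = arrowValue G γ ord a b := by rw [hDa, hda]
  have hanti : D = -(D.flip.compr₂ (TensorProduct.comm k _ _).toLinearMap) := by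
    refine bracket_ext hl (fun a b c => ?_) (fun a => hr (X a)) (fun a b c => ?_)
      (fun s => by simp [hDe]) (fun s c => ?_) her (fun a s => ?_) (fun a b => ?_)
    · simp only [LinearMap.neg_apply, LinearMap.compr₂_apply, LinearMap.flip_apply, hr,
        LinearEquiv.coe_coe, map_add, comm_outerLeft, comm_outerRight, map_neg]
      abel
    · simp only [LinearMap.neg_apply, LinearMap.compr₂_apply, LinearMap.flip_apply, hl,
        LinearEquiv.coe_coe, map_add, comm_innerLeft, comm_innerRight, map_neg]
      abel
    · simp only [LinearMap.neg_apply, LinearMap.compr₂_apply, LinearMap.flip_apply,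
        LinearEquiv.coe_coe, neg_eq_zero, LinearEquiv.map_eq_zero_iff]
      refine derivation_eq_zero (G := G) (γ := γ) (innerLeft k) (innerRight k) (innerLeft_mul k)
        (innerLeft_one k) (fun c => D c (e G γ s)) (by simp) (by simp) ?_ (by simp [hDe])
        (fun a => her a s) c
      intro x y
      rw [hl, add_comm]
    · simp [hDe]
    · simp [hDaa, ← arrowValue_swap]
  have hanti' (a b : LocAlgebra G γ) : D a b = -TensorProduct.comm k _ _ (D b a) :=
    LinearMap.congr_fun₂ hanti a b
  have hbase : ∀ b ∈ Submodule.span k (Set.range (e G γ)), D b = 0 := by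
    intro b hb
    have : Submodule.span k (Set.range (e G γ)) ≤ LinearMap.ker D := by
      rw [Submodule.span_le]
      rintro _ ⟨s, rfl⟩
      exact hDe s
    exact this hb
  refine ⟨D, ⟨hanti', hr, fun b hb a => by rw [hbase b hb]; rfl, fun b hb a => ?_⟩, hDaa⟩
  rw [hanti', hbase b hb]
  simp

variable {G γ ord}

/-- No separate case is needed on the diagonal: `o(a, a) = 0` leaves only two terms of the generic
formula, with opposite signs. -/
theorem arrowValue_self (a : Q ⊕ Q) : arrowValue G γ ord a a =
    ((1 / 2 : k) * (G.endSign ord a (star a) : k)) •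
      ((X a * X a) ⊗ₜ[k] E a - E (star a) ⊗ₜ[k] (X a * X a)) := by
  rw [arrowValue, if_neg (star_ne a).symm, fusionValue, endSign_self, endSign_self,
    endSign_swap ord (star a) a]
  push_cast
  module

theorem arrowValue_star (a : Q) : arrowValue G γ ord (.inl a) (star (.inl a)) =
    gammaBar γ (.inl a) • (E (star (.inl a)) ⊗ₜ[k] E (.inl a))
      + (1 / 2 : k) • ((X (star (.inl a)) * X (.inl a)) ⊗ₜ[k] E (.inl a))
      + (1 / 2 : k) • (E (star (.inl a)) ⊗ₜ[k] (X (.inl a) * X (star (.inl a))))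
      + ((1 / 2 : k) * (G.endSign ord (.inl a) (star (.inl a)) : k)) •
        (X (star (.inl a)) ⊗ₜ[k] X (.inl a) - X (.inl a) ⊗ₜ[k] X (star (.inl a))) := by
  rw [arrowValue, if_pos rfl, fusionValue, pairValue, star_star, endSign_self, endSign_self,
    endSign_swap ord (star _) (.inl a), arrowSign, Sum.elim_inl, Pi.one_apply]
  push_cast
  module

theorem arrowValue_of_ne {b c : Q ⊕ Q} (h : c ≠ star b) :
    arrowValue G γ ord b c = fusionValue G γ ord b c := by
  rw [arrowValue, if_neg h, add_zero]

theorem hasQuiverValues_of_arrowValue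
    {D : LocAlgebra G γ →ₗ[k] LocAlgebra G γ →ₗ[k] LocAlgebra G γ ⊗[k] LocAlgebra G γ}
    (h : ∀ a b, D (X a) (X b) = arrowValue G γ ord a b) : HasQuiverValues G γ ord D where
  self a := by
    rw [h, arrowValue_self, head_double]
    rfl
  opposite a := by
    exact (h _ _).trans (arrowValue_star a)
  distinct b c hc hc' := by
    rw [h, arrowValue_of_ne hc', fusionValue, head_double]
    rfl

theorem arrowValue_of_hasQuiverValues
    {D : LocAlgebra G γ →ₗ[k] LocAlgebra G γ →ₗ[k] LocAlgebra G γ ⊗[k] LocAlgebra G γ}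
    (hD : IsDoubleBracket k (e G γ) D) (h : HasQuiverValues G γ ord D) (a b : Q ⊕ Q) :
    D (X a) (X b) = arrowValue G γ ord a b := by
  have hopp (a : Q) : D (X (.inl a)) (X (star (.inl a))) =
      arrowValue G γ ord (.inl a) (star (.inl a)) := by
    rw [h.opposite, arrowValue_star, head_double]
    rfl
  by_cases hab : b = a
  · rw [hab, h.self, arrowValue_self, head_double]
    rfl
  by_cases hab' : b = star a
  · subst hab'
    rcases a with a | a
    · exact hopp a
    -- The value for an opposite pair is prescribed only with `a ∈ Q` first; antisymmetry supplies
    -- the other order.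
    · rw [hD.antisymm, arrowValue_swap]
      exact congrArg (fun w => -TensorProduct.comm k _ _ w) (hopp a)
  · rw [h.distinct a b hab hab', arrowValue_of_ne hab', fusionValue, head_double]
    rfl

variable (G γ ord) in
/-- There is a unique double bracket with the prescribed values on the arrows. -/
theorem doubleBracket_unique
    {D D' : LocAlgebra G γ →ₗ[k] LocAlgebra G γ →ₗ[k] LocAlgebra G γ ⊗[k] LocAlgebra G γ}
    (hD : IsDoubleBracket k (e G γ) D) (h : ∀ a b, D (X a) (X b) = arrowValue G γ ord a b)
    (hD' : IsDoubleBracket k (e G γ) D') (h' : ∀ a b, D' (X a) (X b) = arrowValue G γ ord a b) :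
    D = D' :=
  bracket_ext hD.mul_left hD'.mul_left (fun a => hD.deriv (X a)) (fun a => hD'.deriv (X a))
    (fun s => hD.base_left _ (Submodule.subset_span ⟨s, rfl⟩))
    (fun s => hD'.base_left _ (Submodule.subset_span ⟨s, rfl⟩))
    (fun _ s => hD.base_right _ (Submodule.subset_span ⟨s, rfl⟩) _)
    (fun _ s => hD'.base_right _ (Submodule.subset_span ⟨s, rfl⟩) _)
    (fun a b => (h a b).trans (h' a b).symm)

end Values

end ArrowQuiver

namespace ArrowQuiver

open DoubleBracket

/-! ### Cyclic sums of ordering signs. -/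

section Ends

variable {k : Type*} [Field k] {I Q : Type*} (G : ArrowQuiver I Q)
  (ord : ∀ s, LinearOrder (G.double.ArrowsFrom s))

local notation "o" => G.endSign ord

/-- The cyclic sum of products of ordering functions. -/
def cyclicSign (x y z : Q ⊕ Q) : k :=
  o x y * o y z + o y z * o z x + o z x * o x y

open Classical in
variable (k) in
/-- The indicator function of the triples of arrows with the same tail. -/
def sameTail (x y z : Q ⊕ Q) : k :=
  if G.double.tail x = G.double.tail y ∧ G.double.tail y = G.double.tail z then 1 else 0

open Classical in
variable (k Q) in
/-- The indicator function of the diagonal. -/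
def diagonal (x y z : Q ⊕ Q) : k := if x = y ∧ y = z then 1 else 0

/-- If the tails are not all equal, at least two of the three signs vanish and so do all products.
The diagonal has to be added back because there the signs vanish although the tails agree. -/
theorem cyclicSign_eq (x y z : Q ⊕ Q) :
    (G.cyclicSign ord x y z : k) = diagonal k Q x y z - sameTail k G x y z := by
  rw [sameTail, diagonal]
  by_cases hd : x = y ∧ y = z
  · obtain ⟨rfl, rfl⟩ := hd
    simp [cyclicSign]
  rw [if_neg hd]
  by_cases h : G.double.tail x = G.double.tail y ∧ G.double.tail y = G.double.tail z
  · rw [if_pos h, cyclicSign, zero_sub]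
    exact_mod_cast congrArg (Int.cast : ℤ → k) (endSign_cyclic ord h.1 h.2 hd)
  · rw [if_neg h, sub_zero, cyclicSign]
    by_cases h₁ : G.double.tail x = G.double.tail y
    · have h₂ : G.double.tail y ≠ G.double.tail z := fun h₂ => h ⟨h₁, h₂⟩
      rw [endSign_of_ne ord h₂, endSign_of_ne ord (fun h₃ => h₂ (h₃.trans h₁).symm)]
      simp
    · rw [endSign_of_ne ord h₁]
      by_cases h₂ : G.double.tail y = G.double.tail z
      · rw [endSign_of_ne ord (fun h₃ => h₁ (h₂.trans h₃).symm)]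
        simp
      · rw [endSign_of_ne ord h₂]
        simp

end Ends

/-! ### The quasi-Poisson property. -/

section QuasiPoisson

variable {k : Type*} [Field k] {I Q : Type*} [Fintype I] (G : ArrowQuiver I Q) (γ : Q → k)
  (ord : ∀ s, LinearOrder (G.double.ArrowsFrom s))

local notation "E" => endIdem G γ
local notation "X" => arr G γ
local notation "o" => G.endSign ord

/-- The combination of triple tensors indexed by a choice of an end of each of three arrows. -/
def endSum (f : Q ⊕ Q → Q ⊕ Q → Q ⊕ Q → k) (a b c : Q ⊕ Q) :
    LocAlgebra G γ ⊗[k] LocAlgebra G γ ⊗[k] LocAlgebra G γ :=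
  f a b (star c) • ((X c * X a) ⊗ₜ X b ⊗ₜ E b)
    - f a (star b) (star c) • ((X c * X a) ⊗ₜ E a ⊗ₜ X b)
    - f (star a) b (star c) • (X c ⊗ₜ (X a * X b) ⊗ₜ E b)
    + f (star a) (star b) (star c) • (X c ⊗ₜ X a ⊗ₜ X b)
    - f a b c • (X a ⊗ₜ X b ⊗ₜ X c)
    + f a (star b) c • (X a ⊗ₜ E a ⊗ₜ (X b * X c))
    + f (star a) b c • (E c ⊗ₜ (X a * X b) ⊗ₜ X c)
    - f (star a) (star b) c • (E c ⊗ₜ X a ⊗ₜ (X b * X c))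

theorem e_mul_arr_of_ne {x : Q ⊕ Q} {s : I} (h : G.double.tail x ≠ s) :
    e G γ s * X x = 0 := by
  rw [← e_mul_arr, ← mul_assoc, (e_completeOrthogonalIdempotents G γ).ortho h.symm, zero_mul]

theorem arr_mul_e_of_ne {x : Q ⊕ Q} {s : I} (h : G.double.tail (star x) ≠ s) :
    X x * e G γ s = 0 := by
  rw [← arr_mul_e_star, mul_assoc, (e_completeOrthogonalIdempotents G γ).ortho h, mul_zero]

/-- In each of the eight terms of the right hand side, `e s` meets one end of each of the three
arrows, so at most one vertex contributes. -/
theorem sum_eq_sameTail {M : Type*} [AddCommGroup M] [Module k M] (x y z : Q ⊕ Q) (g : I → M)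
    (w : M) (h₀ : ∀ s, (G.double.tail x ≠ s ∨ G.double.tail y ≠ s ∨ G.double.tail z ≠ s) → g s = 0)
    (h₁ : G.double.tail x = G.double.tail y → G.double.tail y = G.double.tail z →
      g (G.double.tail x) = w) : ∑ s, g s = sameTail k G x y z • w := by
  rw [Finset.sum_eq_single (G.double.tail x) (fun s _ hs => h₀ s (.inl hs.symm)) (by simp)]
  rw [sameTail]
  split_ifs with h
  · rw [h₁ h.1 h.2, one_smul]
  · rw [zero_smul]
    refine h₀ _ (.inr ?_)
    by_contra! h'
    exact h ⟨h'.1.symm, h'.1.trans h'.2.symm⟩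

theorem quasiTerm_arr (a b c : Q ⊕ Q) : quasiTerm k (e G γ) (X a) (X b) (X c) =
    (1 / 4 : k) • endSum G γ (sameTail k G) a b c := by
  have hl {x : Q ⊕ Q} {s : I} (h : G.double.tail x ≠ s) : e G γ s * X x = 0 :=
    e_mul_arr_of_ne G γ h
  have hr {x : Q ⊕ Q} {s : I} (h : G.double.tail (star x) ≠ s) : X x * e G γ s = 0 :=
    arr_mul_e_of_ne G γ h
  have hl' (x : Q ⊕ Q) : e G γ (G.double.tail x) * X x = X x := e_mul_arr G γ x
  have hr' (x : Q ⊕ Q) : X x * e G γ (G.double.tail (star x)) = X x := arr_mul_e_star x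
  rw [quasiTerm, endSum]
  congr 1
  simp only [Finset.sum_add_distrib, Finset.sum_sub_distrib]
  congr 1
  · congr 1
    · congr 1
      · congr 1
        · congr 1
          · congr 1
            · congr 1
              · refine sum_eq_sameTail G _ _ _ _ _ (fun s h => ?_) (fun h₁ h₂ => ?_)
                · rcases h with h | h | h
                  · simp [mul_assoc, hl h]
                  · simp [hl h]
                  · simp [hr h]
                · rw [mul_assoc, hl', h₁, hl']; rfl
              · refine sum_eq_sameTail G _ _ _ _ _ (fun s h => ?_) (fun h₁ h₂ => ?_)
                · rcases h with h | h | h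
                  · simp [mul_assoc, hl h]
                  · simp [hr h]
                  · simp [hr h]
                · rw [mul_assoc, hl', h₁, hr', ← h₁]; rfl
            · refine sum_eq_sameTail G _ _ _ _ _ (fun s h => ?_) (fun h₁ h₂ => ?_)
              · rcases h with h | h | h
                · simp [hr h]
                · simp [mul_assoc, hl h]
                · simp [hr h]
              · rw [hr', h₁, h₂, hr', ← h₂]; rfl
          · refine sum_eq_sameTail G _ _ _ _ _ (fun s h => ?_) (fun h₁ h₂ => ?_)
            · rcases h with h | h | h <;> simp [hr h]
            · rw [hr', h₁, hr', h₂, hr']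
        · refine sum_eq_sameTail G _ _ _ _ _ (fun s h => ?_) (fun h₁ h₂ => ?_)
          · rcases h with h | h | h <;> simp [hl h]
          · rw [hl', h₁, hl', h₂, hl']
      · refine sum_eq_sameTail G _ _ _ _ _ (fun s h => ?_) (fun h₁ h₂ => ?_)
        · rcases h with h | h | h
          · simp [hl h]
          · simp [hr h]
          · simp [mul_assoc, hl h]
        · rw [hl', h₁, hr', ← h₁]; rfl
    · refine sum_eq_sameTail G _ _ _ _ _ (fun s h => ?_) (fun h₁ h₂ => ?_)
      · rcases h with h | h | h
        · simp [hr h]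
        · simp [mul_assoc, hl h]
        · simp [hl h]
      · rw [hr', h₁, h₂, hl']; rfl
  · refine sum_eq_sameTail G _ _ _ _ _ (fun s h => ?_) (fun h₁ h₂ => ?_)
    · rcases h with h | h | h
      · simp [hr h]
      · simp [hr h]
      · simp [mul_assoc, hl h]
    · rw [hr', h₁, hr', h₂]; rfl

/-- The part of the bracket of `a` with the bracket of `b` and `c` which is quadratic in the
ordering functions. -/
def fusionTriple (a b c : Q ⊕ Q) : LocAlgebra G γ ⊗[k] LocAlgebra G γ ⊗[k] LocAlgebra G γ :=
  (1 / 4 : k) • ((o b c * o a b : k) • (X a ⊗ₜ X b ⊗ₜ X c)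
    + (o b c * o (star a) (star b) : k) • (X b ⊗ₜ X a ⊗ₜ X c)
    - (o b c * o a (star b) : k) • ((X b * X a) ⊗ₜ E a ⊗ₜ X c)
    - (o b c * o (star a) b : k) • (E c ⊗ₜ (X a * X b) ⊗ₜ X c)
    + (o (star b) (star c) * o a c : k) • (X a ⊗ₜ X c ⊗ₜ X b)
    + (o (star b) (star c) * o (star a) (star c) : k) • (X c ⊗ₜ X a ⊗ₜ X b)
    - (o (star b) (star c) * o a (star c) : k) • ((X c * X a) ⊗ₜ E a ⊗ₜ X b)
    - (o (star b) (star c) * o (star a) c : k) • (E c ⊗ₜ (X a * X c) ⊗ₜ X b)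
    - (o b (star c) * o a c : k) • (X a ⊗ₜ (X c * X b) ⊗ₜ E b)
    - (o b (star c) * o (star a) (star c) : k) • (X c ⊗ₜ (X a * X b) ⊗ₜ E b)
    + (o b (star c) * o a (star c) : k) • ((X c * X a) ⊗ₜ X b ⊗ₜ E b)
    + (o b (star c) * o (star a) c : k) • (E c ⊗ₜ (X a * X c * X b) ⊗ₜ E b)
    - (o b (star c) * o a b : k) • ((X c * X a) ⊗ₜ X b ⊗ₜ E b)
    - (o b (star c) * o (star a) (star b) : k) • ((X c * X b) ⊗ₜ X a ⊗ₜ E b)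
    + (o b (star c) * o a (star b) : k) • ((X c * X b * X a) ⊗ₜ E a ⊗ₜ E b)
    + (o b (star c) * o (star a) b : k) • (X c ⊗ₜ (X a * X b) ⊗ₜ E b))

/-- A formal identity using only the antisymmetry of the signs: each of the eight tensors in
`endSum` collects a cyclic sum of products, and all other tensors cancel. -/
theorem fusionTriple_cyclic_sum (a b c : Q ⊕ Q) : fusionTriple G γ ord a b c
    + cyc k (fusionTriple G γ ord b c a) + cyc k (cyc k (fusionTriple G γ ord c a b)) =
    -((1 / 4 : k) • endSum G γ (G.cyclicSign ord) a b c) := by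
  simp only [fusionTriple, map_smul, map_add, map_sub, cyc_tmul, endSum, cyclicSign,
    endSign_swap ord b a, endSign_swap ord b (star a), endSign_swap ord (star b) a,
    endSign_swap ord (star b) (star a),
    endSign_swap ord c a, endSign_swap ord c (star a), endSign_swap ord (star c) a,
    endSign_swap ord (star c) (star a),
    endSign_swap ord c b, endSign_swap ord c (star b), endSign_swap ord (star c) b,
    endSign_swap ord (star c) (star b), Int.cast_neg]
  module

/-- The left hand side expands `{a, -}` on the first factors of `fusionValue b c`, keeping fusion
parts only; the summand with first factor `E (star b)` is absent because idempotents have zero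
bracket. -/
theorem fusion_bracket [CharZero k] (a b c : Q ⊕ Q) :
    -((1 / 2 * o b c : k) • (fusionValue G γ ord a b ⊗ₜ X c))
      - (1 / 2 * o (star b) (star c) : k) • (fusionValue G γ ord a c ⊗ₜ X b)
      + (1 / 2 * o b (star c) : k) • ((outerRight k (X b) (fusionValue G γ ord a c)
        + outerLeft k (X c) (fusionValue G γ ord a b)) ⊗ₜ E b) = fusionTriple G γ ord a b c := by
  -- These four identities bring the idempotents to the normal form of `fusionTriple`, each being
  -- valid because of the sign in front.
  have h₁ : (o b c * o (star a) b : k) • (E (star a) ⊗ₜ[k] (X a * X b) ⊗ₜ[k] X c) =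
      (o b c * o (star a) b : k) • (E c ⊗ₜ[k] (X a * X b) ⊗ₜ[k] X c) := by
    rcases endSign_eq_zero_or G γ ord b c with h | h
    · simp [h]
    rcases endSign_eq_zero_or G γ ord (star a) b with h' | h'
    · simp [h']
    rw [h', h]
  have h₂ (M N : LocAlgebra G γ) : (o (star a) c : k) • (E (star a) ⊗ₜ[k] M ⊗ₜ[k] N) =
      (o (star a) c : k) • (E c ⊗ₜ[k] M ⊗ₜ[k] N) := by
    rcases endSign_eq_zero_or G γ ord (star a) c with h | h
    · simp [h]
    rw [h]
  have h₃ : (o b (star c) * o a (star c) : k) • ((X c * X a) ⊗ₜ[k] (E a * X b) ⊗ₜ[k] E b) =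
      (o b (star c) * o a (star c) : k) • ((X c * X a) ⊗ₜ[k] X b ⊗ₜ[k] E b) := by
    rcases endSign_eq_zero_or G γ ord b (star c) with h | h
    · simp [h]
    rcases endSign_eq_zero_or G γ ord a (star c) with h' | h'
    · simp [h']
    rw [h', ← h, endIdem_mul_arr]
  have h₄ : (o b (star c) * o (star a) b : k) • ((X c * E (star a)) ⊗ₜ[k] (X a * X b) ⊗ₜ[k] E b) =
      (o b (star c) * o (star a) b : k) • (X c ⊗ₜ[k] (X a * X b) ⊗ₜ[k] E b) := by
    rcases endSign_eq_zero_or G γ ord b (star c) with h | h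
    · simp [h]
    rcases endSign_eq_zero_or G γ ord (star a) b with h' | h'
    · simp [h']
    rw [h', h, arr_mul_endIdem]
  simp only [fusionValue, fusionTriple, map_smul, map_add, map_sub, map_neg, outerLeft_tmul,
    outerRight_tmul, TensorProduct.add_tmul, TensorProduct.sub_tmul, TensorProduct.neg_tmul,
    ← TensorProduct.smul_tmul', ← mul_assoc]
  linear_combination (norm := module) (-1 / 4 : k) • h₁
    - (1 / 4 * o (star b) (star c) : k) • h₂ (X a * X c) (X b) + (1 / 4 : k) • h₃
    + (1 / 4 * o b (star c) : k) • h₂ (X a * X c * X b) (E b) + (1 / 4 : k) • h₄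

/-- The action on the inner ends of `x x*` cancels, so that only its outer end contributes. -/
theorem fusionValue_pair_left (x c : Q ⊕ Q) :
    innerRight k (X (star x)) (fusionValue G γ ord x c)
      + innerLeft k (X x) (fusionValue G γ ord (star x) c) =
    (1 / 2 * o x c : k) • (E x ⊗ₜ (X x * X (star x) * X c) - (X x * X (star x)) ⊗ₜ X c)
    + (1 / 2 * o x (star c) : k) • ((X c * (X x * X (star x))) ⊗ₜ E x
      - X c ⊗ₜ (X x * X (star x))) := by
  simp only [fusionValue, map_smul, map_add, map_sub, map_neg, innerLeft_tmul,
    innerRight_tmul, star_star, ← mul_assoc, endIdem_mul_arr, arr_mul_endIdem]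
  module

theorem fusionValue_pair_right (x c : Q ⊕ Q) :
    outerRight k (X (star x)) (fusionValue G γ ord c x)
      + outerLeft k (X x) (fusionValue G γ ord c (star x)) =
    (1 / 2 * o x c : k) • (X c ⊗ₜ (X x * X (star x)) - (X x * X (star x) * X c) ⊗ₜ E x)
    + (1 / 2 * o x (star c) : k) • ((X x * X (star x)) ⊗ₜ X c
      - E x ⊗ₜ (X c * (X x * X (star x)))) := by
  have h := congrArg (fun w => -TensorProduct.comm k _ _ w) (fusionValue_pair_left G γ ord x c)
  simp only [map_add, map_sub, map_smul, TensorProduct.comm_tmul, comm_innerLeft, comm_innerRight,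
    neg_add, ← map_neg (outerLeft k _), ← map_neg (outerRight k _), ← fusionValue_swap] at h
  rw [h]
  module

/-- The contribution of the pairing of `a` with `b` to the bracket of `a` with the bracket of `b`
and `c`. -/
def mixedTripleLeft (a b c : Q ⊕ Q) : LocAlgebra G γ ⊗[k] LocAlgebra G γ ⊗[k] LocAlgebra G γ :=
  -((1 / 2 * o b c : k) • (pairValue G γ a ⊗ₜ X c))
    + (1 / 2 * o b (star c) : k) • (outerLeft k (X c) (pairValue G γ a) ⊗ₜ E b)

/-- The contribution of the pairing of `a` with `c` to the bracket of `a` with the bracket of `b`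
and `c`. -/
def mixedTripleRight (a b c : Q ⊕ Q) : LocAlgebra G γ ⊗[k] LocAlgebra G γ ⊗[k] LocAlgebra G γ :=
  -((1 / 2 * o (star b) (star c) : k) • (pairValue G γ a ⊗ₜ X b))
    + (1 / 2 * o b (star c) : k) • (outerRight k (X b) (pairValue G γ a) ⊗ₜ E b)

/-- The contribution of the pairing of `b` with `b*` to the bracket of `a` with the bracket of `b`
and `b*`. -/
def mixedTripleInner (a b : Q ⊕ Q) : LocAlgebra G γ ⊗[k] LocAlgebra G γ ⊗[k] LocAlgebra G γ :=
  (1 / 2 * arrowSign b : k) • ((outerRight k (X b) (fusionValue G γ ord a (star b))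
    + outerLeft k (X (star b)) (fusionValue G γ ord a b)) ⊗ₜ E b)

/-- By `fusionValue_pair_right` the loop `a* a` interacts with `c` only through its outer end `a*`,
so every term carries `o(a*, c)` or `o(a*, c*)`. What `c` does to the loop inside `pairValue` is
undone by the terms pairing `a` with `a*` inside the fusion value. -/
theorem mixedTriple_sum (a c : Q ⊕ Q) : mixedTripleLeft G γ ord a (star a) c
    + cyc k (mixedTripleRight G γ ord (star a) c a)
    + cyc k (cyc k (mixedTripleInner G γ ord c a)) = 0 := by
  have h := fusionValue_pair_right G γ ord (star a) c
  rw [star_star] at h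
  rw [mixedTripleInner, h]
  simp only [mixedTripleLeft, mixedTripleRight, pairValue_swap]
  simp only [pairValue, map_smul, map_add, map_sub, map_neg, TensorProduct.comm_tmul,
    outerLeft_tmul, outerRight_tmul, TensorProduct.add_tmul, TensorProduct.sub_tmul,
    TensorProduct.neg_tmul, ← TensorProduct.smul_tmul', cyc_tmul, ← mul_assoc,
    endSign_swap ord c (star a), endSign_swap ord (star c) (star a), Int.cast_neg]
  have h₁ : o (star a) c = 0 ∨ (E (star a) = E c ∧ E c * X c = X c) :=
    (endSign_eq_zero_or G γ ord (star a) c).imp_right fun h => ⟨h, endIdem_mul_arr G γ c⟩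
  have h₂ : o (star a) (star c) = 0 ∨ (E (star a) = E (star c) ∧ X c * E (star c) = X c) :=
    (endSign_eq_zero_or G γ ord _ _).imp_right fun h => ⟨h, arr_mul_endIdem G γ c⟩
  rcases h₁ with h₁ | ⟨h₁, h₁'⟩ <;> rcases h₂ with h₂ | ⟨h₂, h₂'⟩
  · simp only [h₁, h₂, Int.cast_zero]; module
  · simp only [h₁, h₂, h₂', Int.cast_zero]; module
  · simp only [h₂, h₁, h₁', Int.cast_zero]; module
  · rw [h₁] at h₂
    simp only [h₁, h₁', ← h₂] at h₂' ⊢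
    simp only [h₂']
    module

open Classical in
variable (k Q) in
/-- The indicator function of the pairs of opposite arrows. -/
def pairing (a b : Q ⊕ Q) : k := if b = star a then 1 else 0

theorem arrowValue_eq (a b : Q ⊕ Q) : arrowValue G γ ord a b =
    fusionValue G γ ord a b + pairing k Q a b • pairValue G γ a := by
  rw [arrowValue, pairing, ite_smul, one_smul, zero_smul]

/-- The part of the bracket of `a` with the bracket of `b` and `c` which does not depend on the
orderings. -/
def pairTriple (a b c : Q ⊕ Q) : LocAlgebra G γ ⊗[k] LocAlgebra G γ ⊗[k] LocAlgebra G γ :=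
  pairing k Q b c • (1 / 2 * arrowSign b : k) •
    ((pairing k Q a (star b) • outerRight k (X b) (pairValue G γ a)
      + pairing k Q a b • outerLeft k (X (star b)) (pairValue G γ a)) ⊗ₜ E b)

/-- This is the quasi-Poisson identity for separated arrow ends, where `diagonal` plays the role of
`sameTail`. Only triples from some `{x, x*}`, not all equal, contribute, and there the terms with
`γ` cancel. For `a = b = c` the two diagonal terms of `endSum` cancel each other. -/
theorem pairTriple_cyclic_sum [CharZero k] (a b c : Q ⊕ Q) : pairTriple G γ a b c
    + cyc k (pairTriple G γ b c a) + cyc k (cyc k (pairTriple G γ c a b)) =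
    (1 / 4 : k) • endSum G γ (diagonal k Q) a b c := by
  have hne (x : Q ⊕ Q) : x ≠ star x := (star_ne x).symm
  have hsgn : (arrowSign a : k) = 1 ∨ (arrowSign a : k) = -1 := by
    cases a <;> simp [arrowSign]
  by_cases hb : b = a
  · subst hb
    by_cases hc : c = b
    · subst hc
      simp [pairTriple, pairing, endSum, diagonal, hne, star_ne]
    by_cases hc' : c = star b
    · subst hc'
      simp only [pairTriple, pairing, endSum, diagonal, hne, star_ne, star_star, arrowSign_star,
        pairValue, gammaBar_star, map_add, map_smul, outerLeft_tmul, outerRight_tmul, if_true,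
        if_false, and_true, true_and, and_self, zero_smul, add_zero, zero_add, map_zero,
        TensorProduct.add_tmul, ← TensorProduct.smul_tmul', cyc_tmul,
        mul_assoc, arr_mul_endIdem, endIdem_mul_arr, arr_star_mul_endIdem]
      rcases hsgn with h | h <;> rw [h] <;> module
    · have h₁ := Ne.symm hc
      have h₂ : b ≠ star c := fun h => hc' (by rw [h, star_star])
      simp [pairTriple, pairing, endSum, diagonal, hc', h₁, h₂, hne, star_ne, star_eq_iff]
  by_cases hb' : b = star a
  · subst hb'
    by_cases hc : c = a
    · subst hc
      simp only [pairTriple, pairing, endSum, diagonal, hne, star_ne, star_star, arrowSign_star,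
        pairValue, gammaBar_star, map_add, map_smul, outerLeft_tmul, outerRight_tmul, if_true,
        if_false, and_true, true_and, and_self, zero_smul, add_zero, zero_add, map_zero,
        TensorProduct.add_tmul, ← TensorProduct.smul_tmul', cyc_tmul,
        mul_assoc, arr_mul_endIdem, endIdem_mul_arr, arr_star_mul_endIdem]
      rcases hsgn with h | h <;> rw [h] <;> module
    by_cases hc' : c = star a
    · subst hc'
      simp only [pairTriple, pairing, endSum, diagonal, hne, star_ne, star_star, arrowSign_star,
        pairValue, gammaBar_star, map_add, map_smul, outerLeft_tmul, outerRight_tmul, if_true,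
        if_false, and_true, true_and, and_self, zero_smul, add_zero, zero_add,
        TensorProduct.add_tmul, ← TensorProduct.smul_tmul', cyc_tmul,
        mul_assoc, arr_mul_endIdem, endIdem_mul_arr, arr_star_mul_endIdem]
      rcases hsgn with h | h <;> rw [h] <;> module
    · have h₁ := Ne.symm hc
      have h₂ : a ≠ star c := fun h => hc' (by rw [h, star_star])
      simp [pairTriple, pairing, endSum, diagonal, hc, h₁, h₂, hne, star_ne, star_eq_iff]
  · have h₁ := Ne.symm hb
    have h₂ : a ≠ star b := fun h => hb' (by rw [h, star_star])
    have h₃ : a = star c → c ≠ star b ∧ star c ≠ star b :=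
      fun h => ⟨fun h' => hb (by rw [h, h', star_star]), fun h' => h₂ (h.trans h')⟩
    by_cases hac : a = star c
    · simp [pairTriple, pairing, endSum, diagonal, hb, hb', h₁, h₂, h₃ hac, star_eq_iff]
    · simp [pairTriple, pairing, endSum, diagonal, hb, hb', h₁, h₂, hac, star_eq_iff]

theorem triple_arr [CharZero k]
    {D : LocAlgebra G γ →ₗ[k] LocAlgebra G γ →ₗ[k] LocAlgebra G γ ⊗[k] LocAlgebra G γ}
    (hD : IsDoubleBracket k (e G γ) D) (h : ∀ a b, D (X a) (X b) = arrowValue G γ ord a b)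
    (a b c : Q ⊕ Q) : triple D (X a) (X b) (X c) = quasiTerm k (e G γ) (X a) (X b) (X c) := by
  have hE (x : LocAlgebra G γ) (y : Q ⊕ Q) : D x (E y) = 0 :=
    hD.base_right _ (Submodule.subset_span ⟨_, rfl⟩) _
  -- The parts are fusion with fusion, the three ways of combining one pairing with one fusion, and
  -- pairing with pairing.
  have key (a b c : Q ⊕ Q) : extend D (X a) (arrowValue G γ ord b c) =
      fusionTriple G γ ord a b c + pairing k Q a b • mixedTripleLeft G γ ord a b c
      + pairing k Q a c • mixedTripleRight G γ ord a b c
      + pairing k Q b c • mixedTripleInner G γ ord a b + pairTriple G γ a b c := by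
    rw [arrowValue_eq, ← fusion_bracket, map_add, map_smul]
    simp only [fusionValue.eq_1 G γ ord b c, pairValue.eq_1 G γ b, map_add, map_sub, map_neg,
      map_smul, extend_tmul, hD.deriv, h, hE, zero_add, add_zero, TensorProduct.zero_tmul,
      smul_zero]
    simp only [mixedTripleLeft, mixedTripleRight, mixedTripleInner, pairTriple]
    simp only [arrowValue_eq, map_add, map_smul, TensorProduct.add_tmul,
      ← TensorProduct.smul_tmul']
    module
  have hpair (a b : Q ⊕ Q) : pairing k Q a b = pairing k Q b a := by
    have : b = star a ↔ a = star b := by rw [← star_eq_iff, eq_comm]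
    by_cases hab : b = star a
    · rw [pairing, pairing, if_pos hab, if_pos (this.1 hab)]
    · rw [pairing, pairing, if_neg hab, if_neg (mt this.2 hab)]
  -- For a fixed opposite pair, each of the three cyclic summands of the triple bracket supplies one
  -- mixed term.
  have hmix (a b c : Q ⊕ Q) : pairing k Q a b • mixedTripleLeft G γ ord a b c
      + cyc k (pairing k Q b a • mixedTripleRight G γ ord b c a)
      + cyc k (cyc k (pairing k Q a b • mixedTripleInner G γ ord c a)) = 0 := by
    rw [hpair b a, map_smul, map_smul, map_smul, ← smul_add, ← smul_add, pairing]
    split_ifs with hab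
    · rw [hab, mixedTriple_sum, smul_zero]
    · rw [zero_smul]
  have h₁ := hmix a b c
  have h₂ := congrArg (cyc k) (hmix b c a)
  have h₃ := congrArg (fun w => cyc k (cyc k w)) (hmix c a b)
  have hF := fusionTriple_cyclic_sum G γ ord a b c
  have hP := pairTriple_cyclic_sum G γ a b c
  -- The diagonal part produced here cancels against the pairing terms, leaving the triples of ends
  -- at one vertex.
  have hS : endSum G γ (G.cyclicSign ord) a b c =
      endSum G γ (diagonal k Q) a b c - endSum G γ (sameTail k G) a b c := by
    simp only [endSum, cyclicSign_eq]
    module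
  rw [hS] at hF
  simp only [map_add, map_zero, cyc_cyc_cyc] at h₁ h₂ h₃
  rw [triple, h, h, h, key, key, key, quasiTerm_arr]
  simp only [map_add]
  linear_combination (norm := module) h₁ + h₂ + h₃ + hF + hP

theorem isDoubleQuasiPoisson [CharZero k]
    {D : LocAlgebra G γ →ₗ[k] LocAlgebra G γ →ₗ[k] LocAlgebra G γ ⊗[k] LocAlgebra G γ}
    (hD : IsDoubleBracket k (e G γ) D) (h : ∀ a b, D (X a) (X b) = arrowValue G γ ord a b) :
    IsDoubleQuasiPoisson k (e G γ) D := by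
  have he (s : I) : D (e G γ s) = 0 :=
    LinearMap.ext fun x => hD.base_left _ (Submodule.subset_span ⟨s, rfl⟩) x
  have he' (a : LocAlgebra G γ) (s : I) : D a (e G γ s) = 0 :=
    hD.base_right _ (Submodule.subset_span ⟨s, rfl⟩) a
  have step (a b : LocAlgebra G γ) (hab : ∀ c, triple D a b (X c) = quasiTerm k (e G γ) a b (X c))
      (c : LocAlgebra G γ) : triple D a b c = quasiTerm k (e G γ) a b c := by
    refine sub_eq_zero.1 ?_
    refine derivation_eq_zero (G := G) (γ := γ) (outerLeft₃ k) (outerRight₃ k) (outerLeft₃_mul k)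
      (outerLeft₃_one k) (fun c => triple D a b c - quasiTerm k (e G γ) a b c) ?_ ?_ ?_ ?_ ?_ c
    · intro x y
      simp only [triple, quasiTerm_eq, map_add, LinearMap.add_apply, extend_add_left,
        outerLeft₃_add, outerRight₃_add, add_sub_add_comm, Finset.sum_add_distrib, smul_add]
      abel
    · intro c x
      have h : quasiTerm k (e G γ) a b (c • x) = c • quasiTerm k (e G γ) a b x := by
        rw [quasiTerm_eq, quasiTerm_eq, smul_comm, Finset.smul_sum (r := c)]
        congr 1
        refine Finset.sum_congr rfl fun s _ => ?_
        rw [outerLeft₃_smul, outerRight₃_smul, smul_sub]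
      rw [h, smul_sub]
      simp only [triple, map_smul, LinearMap.smul_apply, extend_smul_left, smul_add]
    · intro x y
      simp only [hD.triple_mul_right, quasiTerm_mul_right, map_sub]
      abel
    · intro s
      rw [quasiTerm_base _ (e_completeOrthogonalIdempotents G γ).toOrthogonalIdempotents, sub_zero]
      simp only [triple, he, he', LinearMap.zero_apply, map_zero, extend_eq_zero (he s), add_zero]
    · intro c
      rw [hab, sub_self]
  have rotate {a b c : LocAlgebra G γ} (h : triple D a b c = quasiTerm k (e G γ) a b c) :
      triple D c a b = quasiTerm k (e G γ) c a b := by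
    rw [← triple_cyc, h, quasiTerm_cyc]
  refine ⟨e_completeOrthogonalIdempotents G γ, hD, fun a b c => ?_⟩
  -- Both sides are cyclically equivariant, so each argument can be rotated into the last place and
  -- reduced to an arrow there.
  refine step a b (fun z => ?_) c
  refine rotate (rotate (step _ _ (fun y => ?_) b))
  refine rotate (rotate (step _ _ (fun x => ?_) a))
  exact triple_arr G γ ord hD h _ _ _

end QuasiPoisson

end ArrowQuiver

namespace DoubleBracket

/-! ### Leibniz rule for ordered products in a corner `e A e`. -/

section Telescope

variable {k : Type*} [Field k] {A : Type*} [Ring A] [Algebra k A] {ι : Type*}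
  (e : A) (f : ι → A)

/-- The product of the elements `f i` of `e A e` for `i` in a list. -/
def cornerProd (l : List ι) : A := e * (l.map f).prod

variable {e f}

theorem cornerProd_cons (hl : ∀ i, e * f i = f i) (hr : ∀ i, f i * e = f i) (i : ι) (l : List ι) :
    cornerProd e f (i :: l) = f i * cornerProd e f l := by
  rw [cornerProd, cornerProd, List.map_cons, List.prod_cons, ← mul_assoc, ← mul_assoc, hl, hr]

theorem mul_cornerProd (he : e * e = e) (l : List ι) : e * cornerProd e f l = cornerProd e f l := by
  rw [cornerProd, ← mul_assoc, he]

theorem cornerProd_mul (he : e * e = e) (hl : ∀ i, e * f i = f i) (hr : ∀ i, f i * e = f i)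
    (l : List ι) : cornerProd e f l * e = cornerProd e f l := by
  induction l with
  | nil => simp [cornerProd, he]
  | cons i l ih => rw [cornerProd_cons hl hr, mul_assoc, ih]

theorem exists_inv_cornerProd (he : e * e = e) (hl : ∀ i, e * f i = f i) (hr : ∀ i, f i * e = f i)
    (hf : ∀ i, ∃ g, e * g = g ∧ g * e = g ∧ f i * g = e ∧ g * f i = e) (l : List ι) :
    ∃ g, e * g = g ∧ g * e = g ∧ cornerProd e f l * g = e ∧ g * cornerProd e f l = e := by
  induction l with
  | nil => exact ⟨e, he, he, by simp [cornerProd, he], by simp [cornerProd, he]⟩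
  | cons i l ih =>
    obtain ⟨g, h₁, h₂, h₃, h₄⟩ := ih
    obtain ⟨g', h₁', h₂', h₃', h₄'⟩ := hf i
    refine ⟨g * g', by rw [← mul_assoc, h₁], by rw [mul_assoc, h₂'], ?_, ?_⟩
    · rw [cornerProd_cons hl hr, mul_assoc, ← mul_assoc _ g, h₃, h₁', h₃']
    · rw [cornerProd_cons hl hr, mul_assoc, ← mul_assoc g', h₄', mul_cornerProd he, h₄]

variable (k e f) in
/-- The value of an inner derivation rule on a product of elements of `e A e`. -/
def leibniz (T : ι → A ⊗[k] A) : List ι → A ⊗[k] A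
  | [] => 0
  | i :: l => innerLeft k (f i) (leibniz T l) + innerRight k (cornerProd e f l) (T i)

theorem leibniz_add (T H : ι → A ⊗[k] A) (l : List ι) :
    leibniz k e f (fun i => T i + H i) l = leibniz k e f T l + leibniz k e f H l := by
  induction l with
  | nil => simp [leibniz]
  | cons i l ih => simp only [leibniz, ih, map_add]; abel

theorem leibniz_zero (l : List ι) : leibniz k e f (fun _ => 0) l = 0 := by
  induction l with
  | nil => simp [leibniz]
  | cons i l ih => simp [leibniz, ih]

/-- With `P` the product of the later factors, the terms `c P ⊗ f i` from the head and from the tail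
of the list cancel, so the shape of one factor is inherited by the product. -/
theorem leibniz_right_of_gt (hl : ∀ i, e * f i = f i) (hr : ∀ i, f i * e = f i)
    {T : ι → A ⊗[k] A} {c : A} (hc : c * e = c) (l : List ι)
    (hT : ∀ i ∈ l, T i = -((1 / 2 : k) • ((c * f i) ⊗ₜ e - c ⊗ₜ f i))) :
    leibniz k e f T l =
      -((1 / 2 : k) • ((c * cornerProd e f l) ⊗ₜ e - c ⊗ₜ cornerProd e f l)) := by
  induction l with
  | nil => simp [leibniz, cornerProd, hc]
  | cons i l ih =>
    rw [leibniz, hT i (by simp), ih fun j hj => hT j (by simp [hj]), cornerProd_cons hl hr]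
    simp only [map_neg, map_smul, map_sub, innerLeft_tmul, innerRight_tmul, hr, mul_assoc]
    module

/-- Factors before and after `y` contribute with opposite signs; the symmetric value at `y` is
exactly what joins the two telescopes. -/
theorem leibniz_right_of_mem [LinearOrder ι] (hl : ∀ i, e * f i = f i)
    (hr : ∀ i, f i * e = f i) {T : ι → A ⊗[k] A} {c : A} (hc : c * e = c) {y : ι}
    (hT : ∀ i, y < i → T i = -((1 / 2 : k) • ((c * f i) ⊗ₜ e - c ⊗ₜ f i)))
    (hT' : ∀ i, i < y → T i = (1 / 2 : k) • ((c * f i) ⊗ₜ e - c ⊗ₜ f i))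
    (hy : T y = (1 / 2 : k) • ((c * f y) ⊗ₜ e + c ⊗ₜ f y)) (l : List ι)
    (hl' : l.Pairwise (· < ·)) (hm : y ∈ l) :
    leibniz k e f T l =
      (1 / 2 : k) • ((c * cornerProd e f l) ⊗ₜ e + c ⊗ₜ cornerProd e f l) := by
  induction l with
  | nil => simp at hm
  | cons i l ih =>
    rw [List.pairwise_cons] at hl'
    rw [leibniz, cornerProd_cons hl hr]
    rcases List.mem_cons.1 hm with rfl | hm
    · rw [leibniz_right_of_gt hl hr hc l fun j hj => hT j (hl'.1 j hj), hy]
      simp only [map_neg, map_smul, map_sub, map_add, innerLeft_tmul, innerRight_tmul, hr,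
        mul_assoc]
      module
    · rw [ih hl'.2 hm, hT' i (hl'.1 y hm)]
      simp only [map_smul, map_sub, map_add, innerLeft_tmul, innerRight_tmul, hr, mul_assoc]
      module

section

variable (he : e * e = e) (hl : ∀ i, e * f i = f i) (hr : ∀ i, f i * e = f i) {T : ι → A ⊗[k] A}
  {c : A}
include he hl hr

theorem leibniz_left_of_gt (hc : e * c = c) (l : List ι)
    (hT : ∀ i ∈ l, T i = -((1 / 2 : k) • (e ⊗ₜ (f i * c) - f i ⊗ₜ c))) :
    leibniz k e f T l =
      -((1 / 2 : k) • (e ⊗ₜ (cornerProd e f l * c) - cornerProd e f l ⊗ₜ c)) := by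
  induction l with
  | nil => simp [leibniz, cornerProd, hc]
  | cons i l ih =>
    rw [leibniz, hT i (by simp), ih fun j hj => hT j (by simp [hj]), cornerProd_cons hl hr]
    simp only [map_neg, map_smul, map_sub, innerLeft_tmul, innerRight_tmul, mul_cornerProd he,
      mul_assoc]
    module

theorem leibniz_left_of_mem [LinearOrder ι] (hc : e * c = c) {y : ι}
    (hT : ∀ i, y < i → T i = -((1 / 2 : k) • (e ⊗ₜ (f i * c) - f i ⊗ₜ c)))
    (hT' : ∀ i, i < y → T i = (1 / 2 : k) • (e ⊗ₜ (f i * c) - f i ⊗ₜ c))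
    (hy : T y = -((1 / 2 : k) • (f y ⊗ₜ c + e ⊗ₜ (f y * c)))) (l : List ι)
    (hl' : l.Pairwise (· < ·)) (hm : y ∈ l) :
    leibniz k e f T l =
      -((1 / 2 : k) • (e ⊗ₜ (cornerProd e f l * c) + cornerProd e f l ⊗ₜ c)) := by
  induction l with
  | nil => simp at hm
  | cons i l ih =>
    rw [List.pairwise_cons] at hl'
    rw [leibniz, cornerProd_cons hl hr]
    rcases List.mem_cons.1 hm with rfl | hm
    · rw [leibniz_left_of_gt he hl hr hc l fun j hj => hT j (hl'.1 j hj), hy]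
      simp only [map_neg, map_smul, map_sub, map_add, innerLeft_tmul, innerRight_tmul,
        mul_cornerProd he, mul_assoc]
      module
    · rw [ih hl'.2 hm, hT' i (hl'.1 y hm)]
      simp only [map_neg, map_smul, map_sub, map_add, innerLeft_tmul, innerRight_tmul,
        mul_cornerProd he, mul_assoc]
      module

end

theorem IsDoubleBracket.apply_cornerProd {D : A →ₗ[k] A →ₗ[k] A ⊗[k] A} {I : Type*} {e' : I → A}
    (hD : IsDoubleBracket k e' D) (hl : ∀ i, e * f i = f i) (hr : ∀ i, f i * e = f i) {c : A}
    (he : D e c = 0) (l : List ι) :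
    D (cornerProd e f l) c = leibniz k e f (fun i => D (f i) c) l := by
  induction l with
  | nil => simp [cornerProd, he, leibniz]
  | cons i l ih => rw [cornerProd_cons hl hr, hD.mul_left, ih, leibniz]

end Telescope

end DoubleBracket

namespace ArrowQuiver

open DoubleBracket

/-! ### The multiplicative moment map. -/

section Moment

variable {k : Type*} [Field k] {I Q : Type*} [Fintype I] (G : ArrowQuiver I Q) (γ : Q → k)
  (ord : ∀ s, LinearOrder (G.double.ArrowsFrom s))

local notation "E" => endIdem G γ
local notation "X" => arr G γ
local notation "o" => G.endSign ord

/-- The contribution of the tail of `c` to the bracket of a factor `f` at `x` with `c`. -/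
def tailValue (x c : Q ⊕ Q) (σ : k) (f : LocAlgebra G γ) : LocAlgebra G γ ⊗[k] LocAlgebra G γ :=
  (1 / 2 * o x c : k) • (E x ⊗ₜ (f * X c) - f ⊗ₜ X c)
    - pairing k Q (star x) c • (1 / 2 * σ : k) • (f ⊗ₜ X c + E x ⊗ₜ (f * X c))

/-- The contribution of the head of `c` to the bracket of a factor `f` at `x` with `c`. -/
def headValue (x c : Q ⊕ Q) (σ : k) (f : LocAlgebra G γ) : LocAlgebra G γ ⊗[k] LocAlgebra G γ :=
  (1 / 2 * o x (star c) : k) • ((X c * f) ⊗ₜ E x - X c ⊗ₜ f)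
    + pairing k Q x c • (1 / 2 * σ : k) • ((X c * f) ⊗ₜ E x + X c ⊗ₜ f)

theorem localElt_eq (x : Q ⊕ Q) :
    localElt G γ x = gammaBar γ x • E x + X x * X (star x) := rfl

theorem localElt_props (x : Q ⊕ Q) : E x * localElt G γ x = localElt G γ x ∧
    localElt G γ x * E x = localElt G γ x := by
  constructor
  · rw [localElt, mul_add, mul_smul_comm, ← mul_assoc, endIdem_mul_arr, ← endIdem, endIdem_mul_self]
  · rw [localElt, add_mul, smul_mul_assoc, mul_assoc, arr_star_mul_endIdem, ← endIdem,
      endIdem_mul_self]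

theorem localInv_props (x : Q ⊕ Q) : E x * localInv G γ x = localInv G γ x ∧
    localInv G γ x * E x = localInv G γ x := by
  constructor
  · rw [localInv, ← mul_assoc, ← mul_assoc, ← endIdem, endIdem_mul_self]
  · rw [localInv, mul_assoc, ← endIdem, endIdem_mul_self]

/-- The `γ` term splits into two halves, which complete the two quadratic terms to multiples of `γ e
+ x x*`; afterwards `γ` no longer appears separately. -/
theorem pairValue_inner [CharZero k] (x : Q ⊕ Q) : innerLeft k (X x) (pairValue G γ (star x)) =
    -((1 / 2 * arrowSign x : k) • (localElt G γ x ⊗ₜ X x + E x ⊗ₜ (localElt G γ x * X x))) := by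
  simp only [pairValue, localElt_eq, map_add, map_smul, innerLeft_tmul, arrowSign_star,
    star_star, gammaBar_star, TensorProduct.add_tmul, TensorProduct.tmul_add, add_mul,
    smul_mul_assoc, ← TensorProduct.smul_tmul', TensorProduct.tmul_smul, endIdem_mul_arr,
    arr_mul_endIdem, mul_assoc]
  module

theorem pairValue_inner_star [CharZero k] (x : Q ⊕ Q) : innerRight k (X (star x)) (pairValue G γ x) =
    (1 / 2 * arrowSign x : k) • ((X (star x) * localElt G γ x) ⊗ₜ E x
      + X (star x) ⊗ₜ localElt G γ x) := by
  simp only [pairValue, localElt_eq, map_add, map_smul, innerRight_tmul,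
    TensorProduct.add_tmul, TensorProduct.tmul_add, mul_add, mul_smul_comm,
    ← TensorProduct.smul_tmul', TensorProduct.tmul_smul, endIdem_mul_arr,
    arr_star_mul_endIdem, mul_assoc]
  module

theorem exists_inv_momentFactor (x : Q ⊕ Q) : E x * momentFactor G γ x = momentFactor G γ x ∧
    momentFactor G γ x * E x = momentFactor G γ x ∧ ∃ g, E x * g = g ∧ g * E x = g ∧
      momentFactor G γ x * g = E x ∧ g * momentFactor G γ x = E x := by
  have h₁ := localElt_props G γ x
  have h₂ := localInv_props G γ x
  cases x with
  | inl a => exact ⟨h₁.1, h₁.2, _, h₂.1, h₂.2,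
      localElt_mul_localInv G γ _, localInv_mul_localElt G γ _⟩
  | inr a => exact ⟨h₂.1, h₂.2, _, h₁.1, h₁.2,
      localInv_mul_localElt G γ _, localElt_mul_localInv G γ _⟩

end Moment

section MomentBracket

variable {k : Type*} [Field k] [CharZero k] {I Q : Type*} [Fintype I] {G : ArrowQuiver I Q} {γ : Q → k}
  {ord : ∀ s, LinearOrder (G.double.ArrowsFrom s)}

local notation "E" => endIdem G γ
local notation "X" => arr G γ
local notation "o" => G.endSign ord

variable {D : LocAlgebra G γ →ₗ[k] LocAlgebra G γ →ₗ[k] LocAlgebra G γ ⊗[k] LocAlgebra G γ}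
  (hD : IsDoubleBracket k (e G γ) D) (h : ∀ a b, D (arr G γ a) (arr G γ b) = arrowValue G γ ord a b)
include hD h

theorem bracket_localElt (x c : Q ⊕ Q) : D (localElt G γ x) (X c) =
    tailValue G γ ord x c (arrowSign x) (localElt G γ x)
      + headValue G γ ord x c (arrowSign x) (localElt G γ x) := by
  have he : D (e G γ (G.double.tail x)) (X c) = 0 :=
    hD.base_left _ (Submodule.subset_span ⟨_, rfl⟩) _
  have h₀ : D (localElt G γ x) (X c) =
      innerRight k (X (star x)) (fusionValue G γ ord x c)
      + innerLeft k (X x) (fusionValue G γ ord (star x) c)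
      + pairing k Q (star x) c • innerLeft k (X x) (pairValue G γ (star x))
      + pairing k Q x c • innerRight k (X (star x)) (pairValue G γ x) := by
    rw [localElt, map_add, map_smul, LinearMap.add_apply, LinearMap.smul_apply, he, hD.mul_left,
      h, h, arrowValue_eq, arrowValue_eq, map_add, map_add, map_smul, map_smul]
    module
  have h₁ : pairing k Q (star x) c • innerLeft k (X x) (pairValue G γ (star x)) =
      -(pairing k Q (star x) c • (1 / 2 * arrowSign x : k) •
        (localElt G γ x ⊗ₜ X c + E x ⊗ₜ (localElt G γ x * X c))) := by
    rw [pairing, pairValue_inner]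
    split_ifs with hc
    · rw [hc, star_star, smul_neg]
    · simp
  have h₂ : pairing k Q x c • innerRight k (X (star x)) (pairValue G γ x) =
      pairing k Q x c • (1 / 2 * arrowSign x : k) •
        ((X c * localElt G γ x) ⊗ₜ E x + X c ⊗ₜ localElt G γ x) := by
    rw [pairing, pairValue_inner_star]
    split_ifs with hc
    · rw [hc]
    · simp
  -- The fusion parts vanish for `f = E x`, so `γ_x E x` may be added to `x x*` there without
  -- changing them.
  have h₃ : (o x c : k) • (E x ⊗ₜ[k] (E x * X c)) = (o x c : k) • (E x ⊗ₜ[k] X c) := by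
    rcases endSign_eq_zero_or G γ ord x c with h | h
    · simp [h]
    · rw [h, endIdem_mul_arr]
  have h₄ : (o x (star c) : k) • ((X c * E x) ⊗ₜ[k] E x) =
      (o x (star c) : k) • (X c ⊗ₜ[k] E x) := by
    rcases endSign_eq_zero_or G γ ord x (star c) with h | h
    · simp [h]
    · rw [h, arr_mul_endIdem]
  rw [h₀, h₁, h₂, fusionValue_pair_left, tailValue, headValue]
  simp only [localElt_eq, mul_add, add_mul, mul_smul_comm, smul_mul_assoc,
    TensorProduct.add_tmul, TensorProduct.tmul_add, ← TensorProduct.smul_tmul',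
    TensorProduct.tmul_smul]
  linear_combination (norm := module) (-(1 / 2 * gammaBar γ x) : k) • h₃
    - (1 / 2 * gammaBar γ x : k) • h₄

/-- With `φ` the local element and `ψ` its inverse, `{ψ, c}` is minus the inner action of `ψ` on
both sides of `{φ, c}`. This exchanges the two tensors in each part: the antisymmetric fusion parts
keep their sign and the symmetric pairing parts change it. -/
theorem bracket_localInv (x c : Q ⊕ Q) : D (localInv G γ x) (X c) =
    tailValue G γ ord x c (-arrowSign x) (localInv G γ x)
      + headValue G γ ord x c (-arrowSign x) (localInv G γ x) := by
  have he : D (E x) (X c) = 0 := hD.base_left _ (Submodule.subset_span ⟨_, rfl⟩) _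
  obtain ⟨h₁, h₁'⟩ := localElt_props G γ x
  obtain ⟨h₂, h₂'⟩ := localInv_props G γ x
  have h₃ : localElt G γ x * localInv G γ x = E x := localElt_mul_localInv G γ x
  have h₃' : localInv G γ x * localElt G γ x = E x := localInv_mul_localElt G γ x
  have h₄ := bracket_localElt hD h x c
  generalize localElt G γ x = φ at *
  generalize localInv G γ x = ψ at *
  have h₅ : D ψ (X c) = innerLeft k (E x) (D ψ (X c)) := by
    conv_lhs => rw [← h₂, hD.mul_left, he, map_zero, add_zero]
  have h₆ : innerLeft k ψ (D (φ * ψ) (X c)) = 0 := by rw [h₃, he, map_zero]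
  rw [hD.mul_left, map_add, ← innerLeft_mul, h₃', ← h₅, h₄] at h₆
  rw [eq_neg_of_add_eq_zero_left h₆]
  have h₇ : (o x c : k) • (ψ ⊗ₜ[k] (E x * X c)) = (o x c : k) • (ψ ⊗ₜ[k] X c) := by
    rcases endSign_eq_zero_or G γ ord x c with h | h
    · simp [h]
    · rw [h, endIdem_mul_arr]
  have h₈ : (o x (star c) : k) • ((X c * E x) ⊗ₜ[k] ψ) =
      (o x (star c) : k) • (X c ⊗ₜ[k] ψ) := by
    rcases endSign_eq_zero_or G γ ord x (star c) with h | h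
    · simp [h]
    · rw [h, arr_mul_endIdem]
  have h₉ : pairing k Q (star x) c • (ψ ⊗ₜ[k] (E x * X c)) =
      pairing k Q (star x) c • (ψ ⊗ₜ[k] X c) := by
    rw [pairing]
    split_ifs with hc
    · rw [hc, star_star, endIdem_mul_arr]
    · simp
  have h₁₀ : pairing k Q x c • ((X c * E x) ⊗ₜ[k] ψ) = pairing k Q x c • (X c ⊗ₜ[k] ψ) := by
    rw [pairing]
    split_ifs with hc
    · rw [hc, arr_star_mul_endIdem]
    · simp
  have h₁₁ : ψ * (φ * X c) = E x * X c := by rw [← mul_assoc, h₃']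
  simp only [tailValue, headValue, map_add, map_sub, map_smul, innerLeft_tmul, innerRight_tmul,
    mul_assoc, h₂, h₂', h₃, h₃', h₁₁]
  linear_combination (norm := module) (-1 / 2 : k) • h₇ - (1 / 2 : k) • h₈
    + (1 / 2 * arrowSign x : k) • h₉ - (1 / 2 * arrowSign x : k) • h₁₀

theorem bracket_momentFactor (x c : Q ⊕ Q) : D (momentFactor G γ x) (X c) =
    tailValue G γ ord x c 1 (momentFactor G γ x) + headValue G γ ord x c 1 (momentFactor G γ x) := by
  cases x with
  | inl a => exact bracket_localElt hD h (.inl a) c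
  | inr a =>
    refine (bracket_localInv hD h (.inr a) c).trans ?_
    rw [arrowSign, Sum.elim_inr, Pi.neg_apply, Pi.one_apply, neg_neg]
    rfl

theorem bracket_cornerProd {s : I} (l : List (G.double.ArrowsFrom s))
    (hl : letI := ord s; l.Pairwise (· < ·)) (hm : ∀ x, x ∈ l) (c : Q ⊕ Q) :
    D (cornerProd (e G γ s) (fun x => momentFactor G γ x.1) l) (X c) = (1 / 2 : k) •
      ((X c * e G γ s) ⊗ₜ[k] cornerProd (e G γ s) (fun x => momentFactor G γ x.1) l
        - e G γ s ⊗ₜ[k] (cornerProd (e G γ s) (fun x => momentFactor G γ x.1) l * X c)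
        + (X c * cornerProd (e G γ s) (fun x => momentFactor G γ x.1) l) ⊗ₜ[k] e G γ s
        - cornerProd (e G γ s) (fun x => momentFactor G γ x.1) l ⊗ₜ[k] (e G γ s * X c)) := by
  have hE (x : G.double.ArrowsFrom s) : E x.1 = e G γ s := by rw [endIdem, x.2]
  have he := e_idem G γ s
  have hfl (x : G.double.ArrowsFrom s) : e G γ s * momentFactor G γ x.1 = momentFactor G γ x.1 := by
    rw [← hE x]; exact (exists_inv_momentFactor G γ x.1).1
  have hfr (x : G.double.ArrowsFrom s) : momentFactor G γ x.1 * e G γ s = momentFactor G γ x.1 := by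
    rw [← hE x]; exact (exists_inv_momentFactor G γ x.1).2.1
  rw [hD.apply_cornerProd hfl hfr (hD.base_left _ (Submodule.subset_span ⟨s, rfl⟩) _)]
  simp only [bracket_momentFactor hD h, leibniz_add]
  let := ord s
  have hmul := mul_cornerProd (f := fun x : G.double.ArrowsFrom s => momentFactor G γ x.1) he l
  have hmul' := cornerProd_mul he hfl hfr l
  -- The tail and the head of `c` contribute independently, also for a loop. An end away from `s`
  -- gives zero on both sides; an end at `s` is itself a factor of the list and is the point where
  -- the sign changes.
  have htail : leibniz k (e G γ s) (fun x : G.double.ArrowsFrom s => momentFactor G γ x.1)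
      (fun x => tailValue G γ ord x.1 c 1 (momentFactor G γ x.1)) l =
      -((1 / 2 : k) • (e G γ s ⊗ₜ (cornerProd (e G γ s) (fun x => momentFactor G γ x.1) l * X c)
        + cornerProd (e G γ s) (fun x => momentFactor G γ x.1) l ⊗ₜ (e G γ s * X c))) := by
    by_cases hc : G.double.tail c = s
    · have hec : e G γ s * X c = X c := by rw [← hc, e_mul_arr]
      rw [hec]
      refine leibniz_left_of_mem he hfl hfr hec (y := ⟨c, hc⟩) (fun x hx => ?_) (fun x hx => ?_) ?_
        l hl (hm _)
      · have hne : c ≠ x.1 := fun h' => hx.ne (Subtype.ext h')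
        rw [tailValue, hE, endSign_of_gt ord (y := ⟨c, hc⟩) hx, pairing, star_star, if_neg hne]
        push_cast
        module
      · have hne : c ≠ x.1 := fun h' => hx.ne' (Subtype.ext h')
        rw [tailValue, hE, endSign_of_lt ord (y := ⟨c, hc⟩) hx, pairing, star_star, if_neg hne]
        push_cast
        module
      · rw [tailValue, hE, endSign_self, pairing, star_star, if_pos rfl]
        push_cast
        module
    · have hec : e G γ s * X c = 0 := e_mul_arr_of_ne G γ hc
      have hzero (x : G.double.ArrowsFrom s) :
          tailValue G γ ord x.1 c 1 (momentFactor G γ x.1) = 0 := by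
        have hne : c ≠ x.1 := fun h' => hc (by rw [h', x.2])
        rw [tailValue, endSign_of_ne ord (fun h' => hc (h'.symm.trans x.2)), pairing, star_star,
          if_neg hne]
        simp
      simp only [hzero, leibniz_zero]
      rw [← hmul', mul_assoc, hec]
      simp
  have hhead : leibniz k (e G γ s) (fun x : G.double.ArrowsFrom s => momentFactor G γ x.1)
      (fun x => headValue G γ ord x.1 c 1 (momentFactor G γ x.1)) l =
      (1 / 2 : k) • ((X c * cornerProd (e G γ s) (fun x => momentFactor G γ x.1) l) ⊗ₜ e G γ s
        + (X c * e G γ s) ⊗ₜ cornerProd (e G γ s) (fun x => momentFactor G γ x.1) l) := by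
    by_cases hc : G.double.tail (star c) = s
    · have hec : X c * e G γ s = X c := by rw [← hc, arr_mul_e_star]
      rw [hec]
      refine leibniz_right_of_mem hfl hfr hec (y := ⟨star c, hc⟩) (fun x hx => ?_)
        (fun x hx => ?_) ?_ l hl (hm _)
      · have hne : c ≠ star x.1 := fun h' => hx.ne (Subtype.ext ((star_eq_iff _ _).2 h'))
        rw [headValue, hE, endSign_of_gt ord (y := ⟨star c, hc⟩) hx, pairing, if_neg hne]
        push_cast
        module
      · have hne : c ≠ star x.1 := fun h' => hx.ne' (Subtype.ext ((star_eq_iff _ _).2 h'))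
        rw [headValue, hE, endSign_of_lt ord (y := ⟨star c, hc⟩) hx, pairing, if_neg hne]
        push_cast
        module
      · rw [headValue, hE, endSign_self, pairing, star_star, if_pos rfl]
        push_cast
        module
    · have hec : X c * e G γ s = 0 := arr_mul_e_of_ne G γ hc
      have hzero (x : G.double.ArrowsFrom s) :
          headValue G γ ord x.1 c 1 (momentFactor G γ x.1) = 0 := by
        have hne : c ≠ star x.1 := fun h' => hc (by rw [h', star_star, x.2])
        rw [headValue, endSign_of_ne ord (fun h' => hc (h'.symm.trans x.2)), pairing, if_neg hne]
        simp
      simp only [hzero, leibniz_zero]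
      rw [← hmul, ← mul_assoc, hec]
      simp
  rw [htail, hhead]
  module

theorem isMomentMap [Fintype Q] [DecidableEq I] :
    IsMomentMap k (e G γ) D (momentComponent G γ ord) := by
  have hprod (s : I) : ∃ l : List (G.double.ArrowsFrom s), (letI := ord s; l.Pairwise (· < ·)) ∧
      (∀ x, x ∈ l) ∧ momentComponent G γ ord s =
        cornerProd (e G γ s) (fun x => momentFactor G γ x.1) l := by
    let := ord s
    exact ⟨(Finset.univ : Finset (G.double.ArrowsFrom s)).sort (· ≤ ·),
      (Finset.sortedLT_sort _).pairwise, fun x => by simp, by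
        rw [momentComponent, cornerProd]
        simp [← List.map_eq_flatMap, Function.comp_def]⟩
  have hfac (s : I) (x : G.double.ArrowsFrom s) : e G γ s * momentFactor G γ x.1 =
      momentFactor G γ x.1 ∧ momentFactor G γ x.1 * e G γ s = momentFactor G γ x.1 ∧
      ∃ g, e G γ s * g = g ∧ g * e G γ s = g ∧
        momentFactor G γ x.1 * g = e G γ s ∧ g * momentFactor G γ x.1 = e G γ s := by
    have := exists_inv_momentFactor G γ x.1
    rwa [endIdem, x.2] at this
  have hcorner (s : I) : e G γ s * momentComponent G γ ord s = momentComponent G γ ord s ∧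
      momentComponent G γ ord s * e G γ s = momentComponent G γ ord s := by
    obtain ⟨l, -, -, hl⟩ := hprod s
    rw [hl]
    exact ⟨mul_cornerProd (e_idem G γ s) l, cornerProd_mul (e_idem G γ s) (fun x => (hfac s x).1)
      (fun x => (hfac s x).2.1) l⟩
  have hinv (s : I) : ∃ g, e G γ s * g = g ∧ g * e G γ s = g ∧
      momentComponent G γ ord s * g = e G γ s ∧ g * momentComponent G γ ord s = e G γ s := by
    obtain ⟨l, -, -, hl⟩ := hprod s
    rw [hl]
    exact exists_inv_cornerProd (e_idem G γ s) (fun x => (hfac s x).1)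
      (fun x => (hfac s x).2.1) (fun x => (hfac s x).2.2) l
  have hce := e_completeOrthogonalIdempotents G γ
  -- Elements of different corners multiply to zero, so inverses in the corners add up to an inverse
  -- in `A`.
  have hsum (f g : I → LocAlgebra G γ) (hf : ∀ s, f s * e G γ s = f s)
      (hg : ∀ s, e G γ s * g s = g s) (hfg : ∀ s, f s * g s = e G γ s) :
      (∑ s, f s) * ∑ s, g s = 1 := by
    rw [Finset.sum_mul_sum, ← hce.complete]
    refine Finset.sum_congr rfl fun s _ => ?_
    rw [Finset.sum_eq_single s _ (by simp), hfg]
    intro t _ ht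
    rw [← hf, ← hg, mul_assoc, ← mul_assoc (e G γ s), hce.ortho ht.symm, zero_mul, mul_zero]
  refine ⟨fun s => by rw [(hcorner s).1, (hcorner s).2], ?_, fun s a => ?_⟩
  · choose g h₁ h₂ h₃ h₄ using hinv
    exact ⟨⟨_, _, hsum _ g (fun s => (hcorner s).2) h₁ h₃,
      hsum g _ h₂ (fun s => (hcorner s).1) h₄⟩, rfl⟩
  · obtain ⟨l, hl, hm, hΦ⟩ := hprod s
    have harr := bracket_cornerProd hD h l hl hm
    rw [← hΦ] at harr
    obtain ⟨h₁, h₂⟩ := hcorner s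
    generalize momentComponent G γ ord s = Φ at *
    -- The right hand side is a commutator with a fixed tensor, hence a derivation in `a`, and the
    -- comparison on arrows suffices. It vanishes on idempotents because `Φ` lies in the corner at
    -- `s`.
    refine sub_eq_zero.1 ?_
    refine derivation_eq_zero (G := G) (γ := γ) (outerLeft k) (outerRight k)
      (fun a b m => LinearMap.congr_fun (map_mul (outerLeftHom k) a b) m)
      (fun m => LinearMap.congr_fun (map_one (outerLeftHom k)) m)
      (fun a => D Φ a - (1 / 2 : k) • ((a * e G γ s) ⊗ₜ[k] Φ - e G γ s ⊗ₜ[k] (Φ * a)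
        + (a * Φ) ⊗ₜ[k] e G γ s - Φ ⊗ₜ[k] (e G γ s * a))) ?_ ?_ ?_ ?_ ?_ a
    · intro x y
      simp only [map_add, add_mul, mul_add, TensorProduct.add_tmul, TensorProduct.tmul_add]
      module
    · intro c x
      simp only [map_smul, smul_mul_assoc, mul_smul_comm, ← TensorProduct.smul_tmul',
        TensorProduct.tmul_smul]
      module
    · intro x y
      simp only [hD.deriv, map_sub, map_smul, map_add, outerLeft_tmul, outerRight_tmul, mul_assoc]
      module
    · intro t
      rw [hD.base_right _ (Submodule.subset_span ⟨t, rfl⟩)]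
      rcases eq_or_ne t s with rfl | ht
      · rw [h₁, h₂, e_idem]
        module
      · rw [← h₁, ← mul_assoc (e G γ t), hce.ortho ht, mul_assoc, ← h₂, mul_assoc Φ,
          hce.ortho ht.symm]
        simp
    · intro c
      rw [harr, sub_self]

end MomentBracket

end ArrowQuiver
end

theorem mainTheorem3 {k : Type*} [Field k] [CharZero k]
    {I Q : Type*} [Fintype I] [DecidableEq I] [Fintype Q]
    (G : ArrowQuiver I Q) (γ : Q → k)
    (ord : ∀ s : I, LinearOrder (G.double.ArrowsFrom s)) :
    ∃ D : G.LocAlgebra γ →ₗ[k] G.LocAlgebra γ →ₗ[k] G.LocAlgebra γ ⊗[k] G.LocAlgebra γ,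
      DoubleBracket.IsDoubleQuasiPoisson k (G.e γ) D ∧
      G.HasQuiverValues γ ord D ∧
      (∀ D' : G.LocAlgebra γ →ₗ[k] G.LocAlgebra γ →ₗ[k] G.LocAlgebra γ ⊗[k] G.LocAlgebra γ,
        DoubleBracket.IsDoubleBracket k (G.e γ) D' → G.HasQuiverValues γ ord D' → D' = D) ∧
      DoubleBracket.IsMomentMap k (G.e γ) D (G.momentComponent γ ord) := by
  obtain ⟨D, hD, h⟩ := ArrowQuiver.exists_doubleBracket G γ ord
  exact ⟨D, ArrowQuiver.isDoubleQuasiPoisson G γ ord hD h,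
    ArrowQuiver.hasQuiverValues_of_arrowValue h,
    fun D' hD' h' => ArrowQuiver.doubleBracket_unique G γ ord hD'
      (ArrowQuiver.arrowValue_of_hasQuiverValues hD' h') hD h,
    ArrowQuiver.isMomentMap hD h⟩
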